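/- All spaces are real. For finite-dimensional Euclidean spaces $\mathbb E,\mathbb F$, the space $\mathbb E\otimes\mathbb F$ carries the inner product determined by $\langle x\otimes y,x'\otimes y'\rangle=\langle x,x'\rangle\langle y,y'\rangle$. A $0$-symmetric convex body $P\subset\mathbb E$ is a compact convex set with non-empty interior and $P=-P$; $g_P$ is its Minkowski functional, which is the norm on $\mathbb E$ with closed unit ball $P$; and $C^\circ=\{y:\sup_{x\in C}\langle x,y\rangle\le1\}$ is the polar of $C$. Put $$P\otimes_\pi Q=\mathrm{conv}\{x\otimes y:x\in P,\ y\in Q\},\qquad P\otimes_\epsilon Q=(P^\circ\otimes_\pi Q^\circ)^\circ .$$ A tensor product $\otimes_\alpha$ (of order $2$) of $0$-symmetric convex bodies assigns to each pair of $0$-symmetric convex bodies $P\subset\mathbb E$, $Q\subset\mathbb F$ in finite-dimensional Euclidean spaces a $0$-symmetric convex body $P\otimes_\alpha Q\subset\mathbb E\otimes\mathbb F$ such that $P\otimes_\pi Q\subset P\otimes_\alpha Q\subset P\otimes_\epsilon Q$, and such that $(S\otimes T)(P\otimes_\alpha Q)\subset P'\otimes_\alpha Q'$ whenever $S,T$ are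 linear maps with $S(P)\subset P'$ and $T(Q)\subset Q'$. It is injective if $(P\cap M)\otimes_\alpha(Q\cap N)=(P\otimes_\alpha Q)\cap(M\otimes N)$ for all $P,Q$ and all subspaces $M\subset\mathbb E$, $N\subset\mathbb F$ with the induced inner products. The injective hull of $\otimes_\pi$ is $$P\otimes_{\pi^{inj}}Q=\bigcap\{P\otimes_\beta Q:\ \otimes_\beta\text{ is an injective tensor product of $0$-symmetric convex bodies and }\otimes_\pi\subseteq\otimes_\beta\},$$ where $\otimes_\pi\subseteq\otimes_\beta$ means that $P'\otimes_\pi Q'\subset P'\otimes_\beta Q'$ for all pairs $P',Q'$. The Hilbertian tensor product $P\otimes_{\omega_2}Q$ is the set of all $u=\sum_i x_i\otimes y_i\in\mathbb E\otimes\mathbb F$ with $\omega_2(u)\le1$. Here $\omega_2(u)=\|T_u\|_H=\inf\|R\|\,\|S\|$ for the operator $T_u:(\mathbb E,g_P)^*\to(\mathbb F,g_Q)$, $T_u\varphi=\sum_i\varphi(x_i)y_i$, and the infimum is over all factorizations $T_u=RS$ through a Hilbert space with $R,S$ bounded. Let $K_G$ be the (real) Grothendieck constant, i.e. the least $K$ such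 that, for all $m,n$ and every real $m\times n$ matrix $(a_{ij})$ with $|\sum_{i,j}a_{ij}s_it_j|\le1$ for all $s_i,t_j\in[-1,1]$, one has $|\sum_{i,j}a_{ij}\langle x_i,y_j\rangle|\le K$ for all vectors $x_i,y_j$ in the closed unit ball of any real Hilbert space. **Proposition.** The constant $K_G$ is well defined, that is, such a (finite) least $K$ exists, and for all $0$-symmetric convex bodies $P_1\subset\mathbb E_1$, $P_2\subset\mathbb E_2$ in finite-dimensional Euclidean spaces, $$K_G^{-1}\,(P_1\otimes_{\omega_2}P_2)\ \subset\ P_1\otimes_{\pi^{inj}}P_2\ \subset\ P_1\otimes_{\omega_2}P_2 .$$ -/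

import Mathlib

open scoped TensorProduct Pointwise

universe u

noncomputable section

namespace ConvexTensor

/-- `P` is a `0`-symmetric convex body: a compact convex set with nonempty interior and
`P = -P`. -/
structure IsSymConvexBody {E : Type*} [NormedAddCommGroup E] [InnerProductSpace ℝ E]
    (P : Set E) : Prop where
  convex : Convex ℝ P
  isCompact : IsCompact P
  interior_nonempty : (interior P).Nonempty
  neg_eq : -P = P

/-- The polar set `C° = {y : sup_{x ∈ C} ⟪x, y⟫ ≤ 1}`. -/
def polarSet {E : Type*} [NormedAddCommGroup E] [InnerProductSpace ℝ E] (C : Set E) : Set E :=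
  {y | ∀ x ∈ C, inner ℝ x y ≤ 1}

/-- A rule that assigns to subsets `P ⊆ E`, `Q ⊆ F` of Euclidean spaces a subset of `E ⊗ F`.
Only the values on pairs of `0`-symmetric convex bodies are ever used. The space `E ⊗ F` carries
the inner product of the Hilbert tensor product, `⟪x ⊗ y, x' ⊗ y'⟫ = ⟪x, x'⟫ * ⟪y, y'⟫`. -/
def BodyProduct : Type (u + 1) :=
  ∀ (E F : Type u) [NormedAddCommGroup E] [InnerProductSpace ℝ E] [FiniteDimensional ℝ E]
    [NormedAddCommGroup F] [InnerProductSpace ℝ F] [FiniteDimensional ℝ F],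
    Set E → Set F → Set (E ⊗[ℝ] F)

/-- The projective tensor product `P ⊗_π Q = conv {x ⊗ y : x ∈ P, y ∈ Q}`. -/
def projProd : BodyProduct.{u} := fun _ _ _ _ _ _ _ _ P Q =>
  convexHull ℝ {z | ∃ x ∈ P, ∃ y ∈ Q, z = x ⊗ₜ[ℝ] y}

/-- The injective tensor product `P ⊗_ε Q = (P° ⊗_π Q°)°`. -/
def injProd : BodyProduct.{u} := fun E F _ _ _ _ _ _ P Q =>
  polarSet (projProd E F (polarSet P) (polarSet Q))

/-- `⊗_α` is a tensor product (of order two) of `0`-symmetric convex bodies. -/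
structure IsTensorProduct (α : BodyProduct.{u}) : Prop where
  isSymConvexBody : ∀ (E F : Type u)
    [NormedAddCommGroup E] [InnerProductSpace ℝ E] [FiniteDimensional ℝ E]
    [NormedAddCommGroup F] [InnerProductSpace ℝ F] [FiniteDimensional ℝ F]
    (P : Set E) (Q : Set F), IsSymConvexBody P → IsSymConvexBody Q →
    IsSymConvexBody (α E F P Q)
  proj_subset : ∀ (E F : Type u)
    [NormedAddCommGroup E] [InnerProductSpace ℝ E] [FiniteDimensional ℝ E]
    [NormedAddCommGroup F] [InnerProductSpace ℝ F] [FiniteDimensional ℝ F]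
    (P : Set E) (Q : Set F), IsSymConvexBody P → IsSymConvexBody Q →
    projProd E F P Q ⊆ α E F P Q
  subset_inj : ∀ (E F : Type u)
    [NormedAddCommGroup E] [InnerProductSpace ℝ E] [FiniteDimensional ℝ E]
    [NormedAddCommGroup F] [InnerProductSpace ℝ F] [FiniteDimensional ℝ F]
    (P : Set E) (Q : Set F), IsSymConvexBody P → IsSymConvexBody Q →
    α E F P Q ⊆ injProd E F P Q
  uniform : ∀ (E F E' F' : Type u)
    [NormedAddCommGroup E] [InnerProductSpace ℝ E] [FiniteDimensional ℝ E]
    [NormedAddCommGroup F] [InnerProductSpace ℝ F] [FiniteDimensional ℝ F]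
    [NormedAddCommGroup E'] [InnerProductSpace ℝ E'] [FiniteDimensional ℝ E']
    [NormedAddCommGroup F'] [InnerProductSpace ℝ F'] [FiniteDimensional ℝ F']
    (P : Set E) (Q : Set F) (P' : Set E') (Q' : Set F'),
    IsSymConvexBody P → IsSymConvexBody Q → IsSymConvexBody P' → IsSymConvexBody Q' →
    ∀ (S : E →ₗ[ℝ] E') (T : F →ₗ[ℝ] F'), S '' P ⊆ P' → T '' Q ⊆ Q' →
      TensorProduct.map S T '' α E F P Q ⊆ α E' F' P' Q'

/-- `⊗_α` is injective: `(P ∩ M) ⊗_α (Q ∩ N) = (P ⊗_α Q) ∩ (M ⊗ N)` for all subspaces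
`M ⊆ E`, `N ⊆ F` with the induced inner products. Here `P ∩ M` is regarded as a subset of `M`, and
`M ⊗ N` is identified with its image in `E ⊗ F`. -/
def IsInjective (α : BodyProduct.{u}) : Prop :=
  ∀ (E F : Type u)
    [NormedAddCommGroup E] [InnerProductSpace ℝ E] [FiniteDimensional ℝ E]
    [NormedAddCommGroup F] [InnerProductSpace ℝ F] [FiniteDimensional ℝ F]
    (P : Set E) (Q : Set F), IsSymConvexBody P → IsSymConvexBody Q →
    ∀ (M : Submodule ℝ E) (N : Submodule ℝ F),
      TensorProduct.map M.subtype N.subtype '' α M N (M.subtype ⁻¹' P) (N.subtype ⁻¹' Q) =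
        α E F P Q ∩ Set.range (TensorProduct.map M.subtype N.subtype)

/-- The order on tensor products: `P ⊗_α Q ⊆ P ⊗_β Q` for all `0`-symmetric convex bodies. -/
def BodyProduct.Le (α β : BodyProduct.{u}) : Prop :=
  ∀ (E F : Type u)
    [NormedAddCommGroup E] [InnerProductSpace ℝ E] [FiniteDimensional ℝ E]
    [NormedAddCommGroup F] [InnerProductSpace ℝ F] [FiniteDimensional ℝ F]
    (P : Set E) (Q : Set F), IsSymConvexBody P → IsSymConvexBody Q →
    α E F P Q ⊆ β E F P Q

/-- The injective hull `⊗_{α^inj}`: the intersection of all injective tensor products `⊗_β` of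
`0`-symmetric convex bodies with `⊗_α ⊆ ⊗_β`. -/
def injHull (α : BodyProduct.{u}) : BodyProduct.{u} := fun E F _ _ _ _ _ _ P Q =>
  ⋂ (β : BodyProduct.{u}) (_ : IsTensorProduct β ∧ IsInjective β ∧ α.Le β), β E F P Q

/-- `T : (V, p) → (W, q)` is bounded, for norms `p` on `V` and `q` on `W`. -/
def IsBoundedFor {V W : Type*} [AddCommGroup V] [Module ℝ V] [AddCommGroup W] [Module ℝ W]
    (p : V → ℝ) (q : W → ℝ) (T : V →ₗ[ℝ] W) : Prop :=
  ∃ c : ℝ, 0 ≤ c ∧ ∀ v, q (T v) ≤ c * p v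

/-- The operator norm of a bounded operator `T : (V, p) → (W, q)`. -/
def opNormFor {V W : Type*} [AddCommGroup V] [Module ℝ V] [AddCommGroup W] [Module ℝ W]
    (p : V → ℝ) (q : W → ℝ) (T : V →ₗ[ℝ] W) : ℝ :=
  sInf {c : ℝ | 0 ≤ c ∧ ∀ v, q (T v) ≤ c * p v}

/-- The norm `‖T‖_H = inf ‖R‖ ‖S‖` of `T : (V, p) → (W, q)` in the ideal of operators that factor
through a Hilbert space; the infimum is over all factorizations `T = R ∘ S` with `S : V → H` and
`R : H → W` bounded and `H` a real Hilbert space. -/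
def hilbertIdealNorm {V W : Type*} [AddCommGroup V] [Module ℝ V] [AddCommGroup W] [Module ℝ W]
    (p : V → ℝ) (q : W → ℝ) (T : V →ₗ[ℝ] W) : ℝ :=
  sInf {c : ℝ | ∃ (H : Type) (_ : NormedAddCommGroup H) (_ : InnerProductSpace ℝ H)
    (_ : CompleteSpace H) (S : V →ₗ[ℝ] H) (R : H →ₗ[ℝ] W),
    IsBoundedFor p (fun h => ‖h‖) S ∧ IsBoundedFor (fun h => ‖h‖) q R ∧ R ∘ₗ S = T ∧
      c = opNormFor (fun h => ‖h‖) q R * opNormFor p (fun h => ‖h‖) S}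

/-- The norm of the dual space of `(E, g_P)`, where `g_P` is the Minkowski functional of `P`. -/
def dualGauge {E : Type*} [AddCommGroup E] [Module ℝ E] (P : Set E) (φ : Module.Dual ℝ E) : ℝ :=
  opNormFor (gauge P) (fun t : ℝ => |t|) φ

/-- The linear map `T_u : E* → F` of `u = ∑ xᵢ ⊗ yᵢ`, that is, `T_u φ = ∑ φ(xᵢ) yᵢ`. -/
def tensorOperator {E F : Type*} [AddCommGroup E] [Module ℝ E] [AddCommGroup F] [Module ℝ F]
    (u : E ⊗[ℝ] F) : Module.Dual ℝ E →ₗ[ℝ] F :=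
  dualTensorHom ℝ (Module.Dual ℝ E) F
    (TensorProduct.map (Module.Dual.eval ℝ E) LinearMap.id u)

theorem tensorOperator_sum {E F : Type*} [AddCommGroup E] [Module ℝ E] [AddCommGroup F]
    [Module ℝ F] {ι : Type*} (s : Finset ι) (x : ι → E) (y : ι → F) (φ : Module.Dual ℝ E) :
    tensorOperator (∑ i ∈ s, x i ⊗ₜ[ℝ] y i) φ = ∑ i ∈ s, φ (x i) • y i := by
  simp [tensorOperator, map_sum, LinearMap.sum_apply]

/-- The Hilbertian tensor norm `ω₂(u) = ‖T_u : (E, g_P)* → (F, g_Q)‖_H` on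
`(E, g_P) ⊗ (F, g_Q)`. -/
def hilbertianNorm {E F : Type*} [AddCommGroup E] [Module ℝ E] [AddCommGroup F] [Module ℝ F]
    (P : Set E) (Q : Set F) (u : E ⊗[ℝ] F) : ℝ :=
  hilbertIdealNorm (dualGauge P) (gauge Q) (tensorOperator u)

/-- The Hilbertian tensor product `P ⊗_{ω₂} Q`: the closed unit ball of
`(E, g_P) ⊗_{ω₂} (F, g_Q)`. -/
def hilbertianProd : BodyProduct.{u} := fun _ _ _ _ _ _ _ _ P Q =>
  {u | hilbertianNorm P Q u ≤ 1}

/-- The set of all `K` for which the real Grothendieck inequality holds with constant `K`: if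
`|∑ aᵢⱼ sᵢ tⱼ| ≤ 1` for all reals `|sᵢ|, |tⱼ| ≤ 1`, then `|∑ aᵢⱼ ⟪xᵢ, yⱼ⟫| ≤ K` for all vectors
`xᵢ, yⱼ` in the closed unit ball of a real Hilbert space. -/
def grothendieckBounds : Set ℝ :=
  {K | ∀ (m n : ℕ) (a : Matrix (Fin m) (Fin n) ℝ),
    (∀ (s : Fin m → ℝ) (t : Fin n → ℝ), (∀ i, |s i| ≤ 1) → (∀ j, |t j| ≤ 1) →
      |∑ i, ∑ j, a i j * (s i * t j)| ≤ 1) →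
    ∀ (H : Type) [NormedAddCommGroup H] [InnerProductSpace ℝ H] [CompleteSpace H]
      (x : Fin m → H) (y : Fin n → H), (∀ i, ‖x i‖ ≤ 1) → (∀ j, ‖y j‖ ≤ 1) →
      |∑ i, ∑ j, a i j * inner ℝ (x i) (y j)| ≤ K}

/-- The (real) Grothendieck constant `K_G`. -/
def grothendieckConstant : ℝ := sInf grothendieckBounds

end ConvexTensor

end

/-! The proof rests on an explicit description of the ω₂ unit ball: it is `weakTwoProd P Q`, the
tensors ∑ aₖ ⊗ bₖ with ∑ ⟨aₖ, f⟩² ≤ 1 for f ∈ P° and ∑ ⟨bₖ, g⟩² ≤ 1 for g ∈ Q°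
(`hilbertianNorm_le_one_iff`). An orthonormal basis of the range of S turns a factorization RS into
such a sum; conversely, such a sum factors through ℓ₂.

Right inclusion: this set defines an injective tensor product, hence it is one of the sets being
intersected. For injectivity (`weakTwoProd_section`), orthogonal rotations shorten a representation
until both families are linearly independent. A tensor in M ⊗ N then has all aₖ in M and all bₖ in
N, and by Hahn–Banach the weak norms do not grow in the subspaces.

Left inclusion: let β be any injective tensor product. On cubes, a functional bounded by 1 on the
projective product is a matrix satisfying Grothendieck's hypothesis, and its value at a tensor of
`weakTwoProd` is a sum ∑ Aᵢⱼ ⟨xᵢ, yⱼ⟩ over unit balls, so it is at most K_G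
(`inv_smul_map_slabMap_mem`). Every body is, up to 1 + ε, a section of a cube, and injectivity
carries the inclusion over to sections (`inv_smul_mem_of_isInjective`).

K_G is finite by self-improvement: truncating random variables shows that the best constant κ of a
fixed admissible matrix satisfies κ ≤ 4 + κ / 2, so κ ≤ 8 (`BoundsMatrix.improve`). -/

noncomputable section

namespace ConvexTensor

/-! ### Grothendieck's inequality -/

/-- Rademacher sums: a finite uniform probability space with `d` orthonormal functions whose linear
combinations satisfy the fourth moment inequality `E X⁴ ≤ 3 (E X²)²`. -/
theorem exists_rademacher (d : ℕ) : ∃ (Ω : Type) (_ : Fintype Ω) (_ : Nonempty Ω)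
    (r : Fin d → Ω → ℝ),
    (∀ c c' : Fin d → ℝ, ∑ ω, (∑ k, c k * r k ω) * (∑ k, c' k * r k ω) =
      Fintype.card Ω * ∑ k, c k * c' k) ∧
    ∀ c : Fin d → ℝ, ∑ ω, (∑ k, c k * r k ω) ^ 4 ≤ Fintype.card Ω * (3 * (∑ k, c k ^ 2) ^ 2) := by
  induction d with
  | zero => exact ⟨Unit, inferInstance, inferInstance, fun _ _ => 0, by simp, by simp⟩
  | succ d ih =>
    obtain ⟨Ω, _, _, r, h2, h4⟩ := ih
    -- One independent fair sign is adjoined.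
    refine ⟨Ω × Bool, inferInstance, inferInstance,
      Fin.cons (fun ω => if ω.2 then 1 else -1) (fun k ω => r k ω.1), fun c c' => ?_, fun c => ?_⟩
    · have key := h2 (fun k => c k.succ) (fun k => c' k.succ)
      have : ∑ ω : Ω, (c 0 * c' 0 + (∑ k, c (Fin.succ k) * r k ω) * (∑ k, c' (Fin.succ k) * r k ω))
          = Fintype.card Ω * (c 0 * c' 0 + ∑ k : Fin d, c k.succ * c' k.succ) := by
        rw [Finset.sum_add_distrib, key]; simp; ring
      simp only [Fintype.sum_prod_type, Fintype.sum_bool, Fin.sum_univ_succ, Fin.cons_zero,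
        Fin.cons_succ, if_true, Bool.false_eq_true, if_false, Fintype.card_prod, Fintype.card_bool]
      push_cast
      rw [mul_comm (Fintype.card Ω : ℝ) 2, mul_assoc, ← this, Finset.mul_sum]
      exact Finset.sum_congr rfl fun ω _ => by ring
    · have key := h4 (fun k => c k.succ)
      have key2 := h2 (fun k => c k.succ) (fun k => c k.succ)
      set σ : ℝ := ∑ k : Fin d, c k.succ ^ 2 with hσ
      have key2' : ∑ ω : Ω, (∑ k, c (Fin.succ k) * r k ω) ^ 2 = Fintype.card Ω * σ := by
        simpa only [sq, σ] using key2
      -- Averaging over the new sign cancels the odd powers of c₀. What remains is c₀⁴ + 6c₀²σ + 3σ²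
      -- ≤ 3(c₀² + σ)².
      have e : ∑ ω : Ω, ((c 0 + ∑ k, c (Fin.succ k) * r k ω) ^ 4
          + (-c 0 + ∑ k, c (Fin.succ k) * r k ω) ^ 4) =
          2 * (∑ ω : Ω, (∑ k, c (Fin.succ k) * r k ω) ^ 4
            + 6 * c 0 ^ 2 * (∑ ω : Ω, (∑ k, c (Fin.succ k) * r k ω) ^ 2)
            + Fintype.card Ω * c 0 ^ 4) := by
        rw [Finset.mul_sum, ← Finset.sum_add_distrib, ← nsmul_eq_mul, ← Finset.card_univ,
          ← Finset.sum_const, ← Finset.sum_add_distrib, Finset.mul_sum]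
        exact Finset.sum_congr rfl fun ω _ => by ring
      simp only [Fintype.sum_prod_type, Fintype.sum_bool, Fin.sum_univ_succ, Fin.cons_zero,
        Fin.cons_succ, if_true, Bool.false_eq_true, if_false, Fintype.card_prod, Fintype.card_bool,
        mul_one, mul_neg]
      rw [e, key2', ← hσ]
      push_cast
      have hN : (0 : ℝ) ≤ Fintype.card Ω := Nat.cast_nonneg _
      have := mul_nonneg hN (sq_nonneg (c 0 ^ 2))
      nlinarith

/-- Vectors of the unit ball of a Hilbert space as random variables with the same inner products
and with fourth moments at most `3`. -/
theorem exists_random_variables {H ι : Type*} [NormedAddCommGroup H] [InnerProductSpace ℝ H]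
    [Finite ι] (x : ι → H) (hx : ∀ i, ‖x i‖ ≤ 1) :
    ∃ (Ω : Type) (_ : Fintype Ω) (_ : Nonempty Ω) (X : ι → Ω → ℝ),
      (∀ i j, ∑ ω, X i ω * X j ω = Fintype.card Ω * inner ℝ (x i) (x j)) ∧
      ∀ i, ∑ ω, X i ω ^ 4 ≤ Fintype.card Ω * 3 := by
  have : FiniteDimensional ℝ (Submodule.span ℝ (Set.range x)) :=
    FiniteDimensional.span_of_finite ℝ (Set.finite_range x)
  set V := Submodule.span ℝ (Set.range x)
  let b := stdOrthonormalBasis ℝ V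
  let v : ι → V := fun i => ⟨x i, Submodule.subset_span ⟨i, rfl⟩⟩
  obtain ⟨Ω, hΩ, hΩ', r, h2, h4⟩ := exists_rademacher (Module.finrank ℝ V)
  have hin : ∀ i j, ∑ k, inner ℝ (b k) (v i) * inner ℝ (b k) (v j) = inner ℝ (x i) (x j) := by
    intro i j
    have := b.sum_inner_mul_inner (v i) (v j)
    simp only [real_inner_comm (b _) (v i)] at this
    exact this
  refine ⟨Ω, hΩ, hΩ', fun i ω => ∑ k, inner ℝ (b k) (v i) * r k ω, fun i j => ?_, fun i => ?_⟩
  · rw [h2, hin]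
  · refine (h4 _).trans ?_
    have h1 : ∑ k, inner ℝ (b k) (v i) ^ 2 ≤ 1 := by
      simp only [sq, hin, real_inner_self_eq_norm_mul_norm]
      nlinarith [hx i, norm_nonneg (x i)]
    have h0 : 0 ≤ ∑ k, inner ℝ (b k) (v i) ^ 2 := Finset.sum_nonneg fun _ _ => sq_nonneg _
    have : (0 : ℝ) ≤ Fintype.card Ω := Nat.cast_nonneg _
    gcongr
    nlinarith

/-- Truncation of a real number to the interval `[-2, 2]`. -/
def truncateTwo (t : ℝ) : ℝ := max (-2) (min t 2)

theorem abs_truncateTwo_le_two (t : ℝ) : |truncateTwo t| ≤ 2 := by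
  unfold truncateTwo
  rw [abs_le]
  exact ⟨le_max_left _ _, max_le (by norm_num) (min_le_right _ _)⟩

theorem truncateTwo_sq_le (t : ℝ) : truncateTwo t ^ 2 ≤ t ^ 2 := by
  unfold truncateTwo
  rcases le_total t 2 with h | h <;> rcases le_total (-2) t with h' | h'
  · simp [h, h']
  · rw [min_eq_left h, max_eq_left h']; nlinarith
  · rw [min_eq_right h]; norm_num; nlinarith
  · linarith

/-- For |t| ≥ 2 this is the square of 8(|t| - 2) ≤ t², that is, of (|t| - 4)² ≥ 0. It lets the
fourth moment control the truncation error in L₂. -/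
theorem sub_truncateTwo_sq_le (t : ℝ) : 64 * (t - truncateTwo t) ^ 2 ≤ t ^ 4 := by
  unfold truncateTwo
  rcases le_total t 2 with h | h <;> rcases le_total (-2) t with h' | h'
  · rw [min_eq_left h, max_eq_right h']; simp; positivity
  · rw [min_eq_left h, max_eq_left h']
    nlinarith [sq_nonneg (t + 4), sq_nonneg t, mul_nonneg (sq_nonneg (t + 4)) (sq_nonneg t),
      sq_nonneg (t ^ 2 - 8 * (-t - 2)), sq_nonneg (t ^ 2 + 8 * (-t - 2)), mul_nonneg
      (sq_nonneg (t + 4)) (show 0 ≤ t ^ 2 + 8 * (-t - 2) by nlinarith)]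
  · rw [min_eq_right h, max_eq_right (by norm_num)]
    nlinarith [mul_nonneg
      (sq_nonneg (t - 4)) (show 0 ≤ t ^ 2 + 8 * (t - 2) by nlinarith)]
  · linarith

/-- The functions on a finite probability space `Ω` (with the uniform distribution), as vectors. -/
def uniformVector {Ω : Type} [Fintype Ω] (f : Ω → ℝ) : EuclideanSpace ℝ Ω :=
  (√(Fintype.card Ω))⁻¹ • WithLp.toLp 2 f

theorem inner_uniformVector {Ω : Type} [Fintype Ω] (f g : Ω → ℝ) :
    inner ℝ (uniformVector f) (uniformVector g) =
      (Fintype.card Ω : ℝ)⁻¹ * ∑ ω, f ω * g ω := by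
  simp only [uniformVector, inner_smul_left, inner_smul_right, PiLp.inner_apply]
  rw [← mul_assoc]
  congr 1
  · simp [← mul_inv]
  · exact Finset.sum_congr rfl fun ω _ => by simp [mul_comm]

theorem norm_uniformVector_le {Ω : Type} [Fintype Ω] [Nonempty Ω] (f : Ω → ℝ) {c : ℝ}
    (hc : 0 ≤ c) (h : ∑ ω, f ω ^ 2 ≤ Fintype.card Ω * c ^ 2) : ‖uniformVector f‖ ≤ c := by
  refine le_of_sq_le_sq ?_ hc
  rw [← real_inner_self_eq_norm_sq, inner_uniformVector]
  have : (0 : ℝ) < Fintype.card Ω := Nat.cast_pos.2 Fintype.card_pos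
  rw [inv_mul_le_iff₀ this]
  simpa only [sq] using h

/-- `K` bounds the bilinear form of the matrix `a` on the unit balls of all Hilbert spaces. -/
def BoundsMatrix {m n : ℕ} (a : Matrix (Fin m) (Fin n) ℝ) (K : ℝ) : Prop :=
  ∀ (H : Type) [NormedAddCommGroup H] [InnerProductSpace ℝ H] [CompleteSpace H]
    (x : Fin m → H) (y : Fin n → H), (∀ i, ‖x i‖ ≤ 1) → (∀ j, ‖y j‖ ≤ 1) →
    |∑ i, ∑ j, a i j * inner ℝ (x i) (y j)| ≤ K

/-- A crude bound depending on the matrix: the self-improvement argument needs some finite constant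
to start from. -/
theorem boundsMatrix_sum_abs {m n : ℕ} (a : Matrix (Fin m) (Fin n) ℝ) :
    BoundsMatrix a (∑ i, ∑ j, |a i j|) := by
  intro H _ _ _ x y hx hy
  refine (Finset.abs_sum_le_sum_abs _ _).trans (Finset.sum_le_sum fun i _ => ?_)
  refine (Finset.abs_sum_le_sum_abs _ _).trans (Finset.sum_le_sum fun j _ => ?_)
  rw [abs_mul]
  refine mul_le_of_le_one_right (abs_nonneg _) ((abs_real_inner_le_norm _ _).trans ?_)
  exact mul_le_one₀ (hx i) (norm_nonneg _) (hy j)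

/-- Realize the vectors as random variables Z = T + D with |T| ≤ 2 and D small in L₂. The T–T part
is estimated pointwise by the hypothesis on `a`; the two parts containing D are again inner products
of vectors, to which the old bound K applies with a gain of 1/4 each. -/
theorem BoundsMatrix.improve {m n : ℕ} {a : Matrix (Fin m) (Fin n) ℝ} {K : ℝ}
    (hK : BoundsMatrix a K)
    (ha : ∀ (s : Fin m → ℝ) (t : Fin n → ℝ), (∀ i, |s i| ≤ 1) → (∀ j, |t j| ≤ 1) →
      |∑ i, ∑ j, a i j * (s i * t j)| ≤ 1) :
    BoundsMatrix a (4 + K / 2) := by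
  intro H _ _ _ x y hx hy
  -- Both families are realized on the same probability space, so that the mixed inner products are
  -- reproduced.
  obtain ⟨Ω, _, _, Z, hZ2, hZ4⟩ := exists_random_variables (Sum.elim x y)
    (by rintro (i | j); exacts [hx i, hy j])
  have hN : (0 : ℝ) < Fintype.card Ω := Nat.cast_pos.2 Fintype.card_pos
  have hZ1 : ∀ p, ∑ ω, Z p ω ^ 2 ≤ Fintype.card Ω * 1 ^ 2 := by
    intro p
    have : ‖Sum.elim x y p‖ ≤ 1 := by rcases p with i | j; exacts [hx i, hy j]
    simp only [sq, hZ2, real_inner_self_eq_norm_mul_norm]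
    gcongr
  let T : Fin m ⊕ Fin n → Ω → ℝ := fun p ω => truncateTwo (Z p ω)
  let D : Fin m ⊕ Fin n → Ω → ℝ := fun p ω => Z p ω - T p ω
  have nT : ∀ p, ‖uniformVector (T p)‖ ≤ 1 := fun p => norm_uniformVector_le _ zero_le_one
    ((Finset.sum_le_sum fun ω _ => truncateTwo_sq_le _).trans (hZ1 p))
  have nZ : ∀ p, ‖uniformVector (Z p)‖ ≤ 1 := fun p => norm_uniformVector_le _ zero_le_one (hZ1 p)
  have nD : ∀ p, ‖(4 : ℝ) • uniformVector (D p)‖ ≤ 1 := by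
    intro p
    rw [norm_smul]
    -- Here E D² ≤ E Z⁴ / 64 ≤ 3/64 ≤ 1/16.
    have : ‖uniformVector (D p)‖ ≤ 1 / 4 := by
      refine norm_uniformVector_le _ (by norm_num) ?_
      have h1 : 64 * ∑ ω, D p ω ^ 2 ≤ ∑ ω, Z p ω ^ 4 := by
        rw [Finset.mul_sum]
        exact Finset.sum_le_sum fun ω _ => sub_truncateTwo_sq_le _
      nlinarith [hZ4 p]
    norm_num
    linarith
  have h1 : |∑ i, ∑ j, a i j * ((Fintype.card Ω : ℝ)⁻¹ *
      ∑ ω, T (Sum.inl i) ω * T (Sum.inr j) ω)| ≤ 4 := by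
    have e : ∑ i, ∑ j, a i j * ((Fintype.card Ω : ℝ)⁻¹ *
      ∑ ω, T (Sum.inl i) ω * T (Sum.inr j) ω) = (Fintype.card Ω : ℝ)⁻¹ * ∑ ω, 4 *
        ∑ i, ∑ j, a i j * ((T (Sum.inl i) ω / 2) * (T (Sum.inr j) ω / 2)) := by
      simp only [Finset.mul_sum]
      rw [Finset.sum_comm' (t' := Finset.univ) (s' := fun _ => Finset.univ) (by simp)]
      rw [Finset.sum_comm]
      conv_rhs => rw [Finset.sum_comm]
      refine Finset.sum_congr rfl fun i _ => ?_
      conv_rhs => rw [Finset.sum_comm]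
      refine Finset.sum_congr rfl fun j _ => Finset.sum_congr rfl fun ω _ => by ring
    rw [e, abs_mul, abs_of_pos (inv_pos.2 hN), inv_mul_le_iff₀ hN]
    refine (Finset.abs_sum_le_sum_abs _ _).trans ?_
    have : ∀ ω ∈ Finset.univ, |4 * ∑ i, ∑ j, a i j * ((T (Sum.inl i) ω / 2) *
        (T (Sum.inr j) ω / 2))| ≤ 4 := by
      intro ω _
      have hT : ∀ p, |T p ω / 2| ≤ 1 := by
        intro p
        rw [abs_div, abs_two, div_le_one two_pos]
        exact abs_truncateTwo_le_two _
      have := ha (fun i => T (Sum.inl i) ω / 2) (fun j => T (Sum.inr j) ω / 2)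
        (fun i => hT _) (fun j => hT _)
      rw [abs_mul]
      norm_num
      linarith
    refine (Finset.sum_le_card_nsmul _ _ 4 this).trans ?_
    simp
  have h2 := hK _ (fun i => (4 : ℝ) • uniformVector (D (Sum.inl i)))
    (fun j => uniformVector (T (Sum.inr j))) (fun i => nD _) (fun j => nT _)
  have h3 := hK _ (fun i => uniformVector (Z (Sum.inl i)))
    (fun j => (4 : ℝ) • uniformVector (D (Sum.inr j))) (fun i => nZ _) (fun j => nD _)
  -- The splitting ZZ' = TT' + DT' + ZD' keeps exactly one small factor in each error term.
  have e : ∑ i, ∑ j, a i j * inner ℝ (x i) (y j) =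
      ∑ i, ∑ j, a i j * ((Fintype.card Ω : ℝ)⁻¹ * ∑ ω, T (Sum.inl i) ω * T (Sum.inr j) ω) +
      (∑ i, ∑ j, a i j * inner ℝ ((4 : ℝ) • uniformVector (D (Sum.inl i)))
        (uniformVector (T (Sum.inr j)))) / 4 +
      (∑ i, ∑ j, a i j * inner ℝ (uniformVector (Z (Sum.inl i)))
        ((4 : ℝ) • uniformVector (D (Sum.inr j)))) / 4 := by
    simp only [Finset.sum_div, ← Finset.sum_add_distrib]
    refine Finset.sum_congr rfl fun i _ => Finset.sum_congr rfl fun j _ => ?_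
    have hz := hZ2 (Sum.inl i) (Sum.inr j)
    simp only [Sum.elim_inl, Sum.elim_inr] at hz
    have hz' : inner ℝ (x i) (y j) =
        (Fintype.card Ω : ℝ)⁻¹ * ∑ ω, Z (Sum.inl i) ω * Z (Sum.inr j) ω := by
      rw [hz, inv_mul_cancel_left₀ hN.ne']
    have hs : ∑ ω, Z (Sum.inl i) ω * Z (Sum.inr j) ω = ∑ ω, T (Sum.inl i) ω * T (Sum.inr j) ω +
        ∑ ω, D (Sum.inl i) ω * T (Sum.inr j) ω + ∑ ω, Z (Sum.inl i) ω * D (Sum.inr j) ω := by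
      rw [← Finset.sum_add_distrib, ← Finset.sum_add_distrib]
      exact Finset.sum_congr rfl fun ω _ => by simp only [D]; ring
    rw [hz', hs, real_inner_smul_left, real_inner_smul_right, inner_uniformVector,
      inner_uniformVector]
    ring
  rw [e]
  rw [abs_le] at *
  constructor <;> linarith

/-- Grothendieck's inequality, with a constant that is not optimal. -/
theorem eight_mem_grothendieckBounds : 8 ∈ grothendieckBounds := by
  intro m n a ha
  have hbdd : BddBelow {K | BoundsMatrix a K} :=
    ⟨0, fun K hK => (abs_nonneg _).trans (hK ℝ (fun _ => 0) (fun _ => 0) (by simp) (by simp))⟩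
  have hne : {K | BoundsMatrix a K}.Nonempty := ⟨_, boundsMatrix_sum_abs a⟩
  have hmem : BoundsMatrix a (sInf {K | BoundsMatrix a K}) := by
    intro H _ _ _ x y hx hy
    exact le_csInf hne fun K hK => hK H x y hx hy
  -- The infimum κ is itself a bound, so κ ≤ 4 + κ / 2, which gives κ ≤ 8.
  have hle := csInf_le hbdd (hmem.improve ha)
  intro H _ _ _ x y hx hy
  exact (hmem H x y hx hy).trans (by linarith)

theorem one_le_of_mem_grothendieckBounds {K : ℝ} (hK : K ∈ grothendieckBounds) : 1 ≤ K := by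
  have := hK 1 1 (fun _ _ => 1) (by
    intro s t hs ht
    simpa [abs_mul] using mul_le_one₀ (hs 0) (abs_nonneg _) (ht 0)) ℝ (fun _ => 1) (fun _ => 1)
    (by simp) (by simp)
  simpa using this

theorem isLeast_grothendieckConstant : IsLeast grothendieckBounds grothendieckConstant := by
  refine ⟨fun m n a ha H _ _ _ x y hx hy => ?_, fun K hK =>
    csInf_le ⟨1, fun K hK => one_le_of_mem_grothendieckBounds hK⟩ hK⟩
  exact le_csInf ⟨8, eight_mem_grothendieckBounds⟩ fun K hK => hK m n a ha H x y hx hy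

theorem one_le_grothendieckConstant : 1 ≤ grothendieckConstant :=
  one_le_of_mem_grothendieckBounds isLeast_grothendieckConstant.1

/-! ### Symmetric convex bodies and their polars -/

section Body

variable {E : Type*} [NormedAddCommGroup E] [InnerProductSpace ℝ E] {P : Set E}

theorem IsSymConvexBody.neg_mem (hP : IsSymConvexBody P) {x : E} (hx : x ∈ P) : -x ∈ P := by
  rw [← hP.neg_eq]
  simpa using hx

theorem IsSymConvexBody.mem_nhds_zero (hP : IsSymConvexBody P) : P ∈ nhds (0 : E) := by
  obtain ⟨x, hx⟩ := hP.interior_nonempty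
  have hx' : -x ∈ P := hP.neg_mem (interior_subset hx)
  have := hP.convex.combo_interior_self_mem_interior hx hx' (a := 1 / 2) (b := 1 / 2)
    (by norm_num) (by norm_num) (by norm_num)
  rw [smul_neg, add_neg_cancel] at this
  exact mem_interior_iff_mem_nhds.1 this

theorem IsSymConvexBody.zero_mem (hP : IsSymConvexBody P) : (0 : E) ∈ P :=
  mem_of_mem_nhds hP.mem_nhds_zero

theorem IsSymConvexBody.of_mem_nhds (h1 : Convex ℝ P) (h2 : IsCompact P) (h3 : P ∈ nhds (0 : E))
    (h4 : ∀ x ∈ P, -x ∈ P) : IsSymConvexBody P where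
  convex := h1
  isCompact := h2
  interior_nonempty := ⟨0, mem_interior_iff_mem_nhds.2 h3⟩
  neg_eq := by
    ext x
    exact ⟨fun h => by simpa using h4 _ h, fun h => h4 _ h⟩

theorem IsSymConvexBody.absorbent (hP : IsSymConvexBody P) : Absorbent ℝ P :=
  absorbent_nhds_zero hP.mem_nhds_zero

theorem IsSymConvexBody.gauge_le_one_iff (hP : IsSymConvexBody P) {x : E} :
    gauge P x ≤ 1 ↔ x ∈ P := by
  rw [gauge_le_one_iff_mem_closure hP.convex hP.mem_nhds_zero, hP.isCompact.isClosed.closure_eq]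

theorem IsSymConvexBody.gauge_le_iff (hP : IsSymConvexBody P) {x : E} {t : ℝ} (ht : 0 < t) :
    gauge P x ≤ t ↔ t⁻¹ • x ∈ P := by
  rw [← hP.gauge_le_one_iff, gauge_smul_of_nonneg (inv_nonneg.2 ht.le), smul_eq_mul,
    inv_mul_le_iff₀ ht, mul_one]

theorem IsSymConvexBody.smul_mem (hP : IsSymConvexBody P) {x : E} (hx : x ∈ P) {t : ℝ}
    (h0 : 0 ≤ t) (h1 : t ≤ 1) : t • x ∈ P :=
  hP.convex.smul_mem_of_zero_mem hP.zero_mem hx ⟨h0, h1⟩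

theorem IsSymConvexBody.exists_eq_smul (hP : IsSymConvexBody P) (x : E) :
    ∃ t : ℝ, ∃ y ∈ P, x = t • y := by
  have h : 0 < gauge P x + 1 := add_pos_of_nonneg_of_pos (gauge_nonneg _) one_pos
  exact ⟨gauge P x + 1, _, (hP.gauge_le_iff h).1 (by linarith), by rw [smul_inv_smul₀ h.ne']⟩

/-- If `⟪·, f⟫ ≤ t` on `P` then `⟪x, ·⟫ ≤ t g_P`. -/
theorem IsSymConvexBody.inner_le_mul_gauge (hP : IsSymConvexBody P) {f : E} {t : ℝ}
    (h : ∀ x ∈ P, inner ℝ x f ≤ t) (x : E) : inner ℝ x f ≤ t * gauge P x := by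
  have ht : 0 ≤ t := by simpa using h 0 hP.zero_mem
  have key : ∀ s, gauge P x < s → inner ℝ x f ≤ t * s := by
    intro s hs
    have hs0 : 0 < s := (gauge_nonneg x).trans_lt hs
    have := h _ ((hP.gauge_le_iff hs0).1 hs.le)
    rw [real_inner_smul_left, inv_mul_le_iff₀ hs0] at this
    linarith
  have hlim : Filter.Tendsto (fun s : ℝ => t * s) (nhdsWithin (gauge P x) (Set.Ioi (gauge P x)))
      (nhds (t * gauge P x)) := (continuous_const.mul continuous_id).continuousWithinAt
  exact ge_of_tendsto hlim (Filter.eventually_of_mem self_mem_nhdsWithin key)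

/-- Removes ε-losses at the end of an approximation. It is used with n = 1 for nearly optimal
factorizations and n = 2 when each tensor factor loses 1 + ε. -/
theorem _root_.IsClosed.mem_of_forall_inv_pow_smul_mem {W : Set E} (hW : IsClosed W) {u : E} (n : ℕ)
    (h : ∀ ε : ℝ, 0 < ε → ε ≤ 1 → ((1 + ε)⁻¹ ^ n) • u ∈ W) : u ∈ W := by
  have hlim : Filter.Tendsto (fun ε : ℝ => ((1 + ε)⁻¹ ^ n) • u) (nhdsWithin 0 (Set.Ioi 0))
      (nhds u) := by
    have : ContinuousAt (fun ε : ℝ => ((1 + ε)⁻¹ ^ n) • u) 0 := by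
      have : ContinuousAt (fun ε : ℝ => (1 + ε)⁻¹) 0 :=
        (continuousAt_const.add continuousAt_id).inv₀ (by simp)
      exact (this.pow n).smul continuousAt_const
    simpa using (this.continuousWithinAt (s := Set.Ioi 0)).tendsto
  exact hW.mem_of_tendsto hlim (Filter.eventually_of_mem (Ioc_mem_nhdsGT one_pos)
    fun ε hε => h ε hε.1 hε.2)

theorem abs_inner_le_one (hP : IsSymConvexBody P) {f x : E} (hf : f ∈ polarSet P) (hx : x ∈ P) :
    |inner ℝ x f| ≤ 1 := by
  rw [abs_le']
  refine ⟨hf x hx, ?_⟩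
  rw [← inner_neg_left]
  exact hf _ (hP.neg_mem hx)

variable [FiniteDimensional ℝ E]

/-- The bipolar theorem. -/
theorem IsSymConvexBody.mem_of_forall_polarSet (hP : IsSymConvexBody P) {x : E}
    (h : ∀ f ∈ polarSet P, inner ℝ x f ≤ 1) : x ∈ P := by
  by_contra hx
  obtain ⟨φ, t, h1, h2⟩ := geometric_hahn_banach_closed_point hP.convex hP.isCompact.isClosed hx
  have ht : 0 < t := by simpa using h1 0 hP.zero_mem
  let f := (InnerProductSpace.toDual ℝ E).symm φ
  have hf : ∀ y, inner ℝ y f = φ y := fun y => by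
    rw [real_inner_comm]; exact InnerProductSpace.toDual_symm_apply
  have := h (t⁻¹ • f) fun y hy => by
    rw [real_inner_smul_right, hf, inv_mul_le_iff₀ ht, mul_one]
    exact (h1 y hy).le
  rw [real_inner_smul_right, hf, inv_mul_le_iff₀ ht, mul_one] at this
  linarith

theorem isCompact_polarSet (hP : IsSymConvexBody P) : IsCompact (polarSet P) := by
  obtain ⟨r, hr, hrP⟩ := Metric.nhds_basis_closedBall.mem_iff.1 hP.mem_nhds_zero
  refine Metric.isCompact_of_isClosed_isBounded ?_ ?_
  · simp only [polarSet, Set.ofPred_forall]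
    exact isClosed_iInter fun x => isClosed_iInter fun _ =>
      isClosed_le (continuous_const.inner continuous_id) continuous_const
  · refine (Metric.isBounded_closedBall (x := (0 : E)) (r := r⁻¹)).subset fun f hf => ?_
    rw [mem_closedBall_zero_iff]
    rcases eq_or_ne f 0 with rfl | h0
    · simpa using hr.le
    have hn : 0 < ‖f‖ := norm_pos_iff.2 h0
    have := hf ((r / ‖f‖) • f) (hrP (by
      rw [mem_closedBall_zero_iff, norm_smul, norm_div, norm_norm, div_mul_cancel₀ _ hn.ne']
      simp [abs_of_pos hr]))
    rw [real_inner_smul_left, real_inner_self_eq_norm_sq] at this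
    rw [le_inv_comm₀ hn hr, ← one_div, le_div_iff₀ hn]
    calc r * ‖f‖ = r / ‖f‖ * ‖f‖ ^ 2 := by field_simp
      _ ≤ 1 := this

/-- The polar of a section `P ∩ M` consists of restrictions of elements of the polar of `P`. -/
theorem exists_polarSet_extension (hP : IsSymConvexBody P) (M : Submodule ℝ E) {f : M}
    (hf : f ∈ polarSet (M.subtype ⁻¹' P)) :
    ∃ g ∈ polarSet P, ∀ x : M, inner ℝ (x : E) g = inner ℝ x f := by
  obtain ⟨φ, h1, h2⟩ := exists_extension_of_le_sublinear
    (E := E) ⟨M, (innerₛₗ ℝ f : M →ₗ[ℝ] ℝ)⟩ (gauge P)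
    (fun c hc x => by rw [gauge_smul_of_nonneg hc.le, smul_eq_mul])
    (gauge_add_le hP.convex hP.absorbent) (fun x => by
      refine le_of_forall_gt_imp_ge_of_dense fun s hs => ?_
      have hs0 : 0 < s := (gauge_nonneg _).trans_lt hs
      have := hf (s⁻¹ • x) ((hP.gauge_le_iff hs0).1 hs.le)
      rw [real_inner_smul_left, inv_mul_le_iff₀ hs0, mul_one, real_inner_comm] at this
      exact this)
  let g := (InnerProductSpace.toDual ℝ E).symm (LinearMap.toContinuousLinearMap φ)
  have hg : ∀ y, inner ℝ y g = φ y := fun y => by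
    rw [real_inner_comm]; exact InnerProductSpace.toDual_symm_apply
  refine ⟨g, fun x hx => ?_, fun x => ?_⟩
  · rw [hg]
    exact (h2 x).trans (hP.gauge_le_one_iff.2 hx)
  · rw [hg, h1 x, real_inner_comm]
    rfl

theorem IsSymConvexBody.preimage_subtype (hP : IsSymConvexBody P) (M : Submodule ℝ E) :
    IsSymConvexBody (M.subtype ⁻¹' P) :=
  .of_mem_nhds (hP.convex.linear_preimage M.subtype)
    ((Submodule.closed_of_finiteDimensional M).isClosedEmbedding_subtypeVal.isCompact_preimage
      hP.isCompact)
    (continuous_subtype_val.continuousAt.preimage_mem_nhds (by simpa using hP.mem_nhds_zero))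
    (fun x hx => by simpa using hP.neg_mem hx)

/-- The unit ball of `ℓ_∞`. -/
def cube (ι : Type*) : Set (EuclideanSpace ℝ ι) := {x | ∀ i, |x i| ≤ 1}

theorem isSymConvexBody_cube (ι : Type*) [Fintype ι] : IsSymConvexBody (cube ι) := by
  have e : cube ι = ⋂ i, {x : EuclideanSpace ℝ ι | |x i| ≤ 1} := by ext; simp [cube]
  refine .of_mem_nhds ?_ (Metric.isCompact_of_isClosed_isBounded ?_ ?_) ?_ ?_
  · intro x hx y hy a b ha hb hab i
    have hx := abs_le.1 (hx i)
    have hy := abs_le.1 (hy i)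
    simp only [PiLp.add_apply, PiLp.smul_apply, smul_eq_mul]
    rw [abs_le]
    constructor <;> nlinarith
  · rw [e]
    exact isClosed_iInter fun i => isClosed_le (by fun_prop) continuous_const
  · refine (Metric.isBounded_closedBall (x := (0 : EuclideanSpace ℝ ι))
      (r := √(Fintype.card ι))).subset fun x hx => ?_
    rw [mem_closedBall_zero_iff, EuclideanSpace.norm_eq]
    refine Real.sqrt_le_sqrt ?_
    refine (Finset.sum_le_card_nsmul _ _ 1 fun i _ => ?_).trans (by simp)
    rw [Real.norm_eq_abs]
    exact pow_le_one₀ (abs_nonneg _) (hx i)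
  · refine Filter.mem_of_superset (Metric.closedBall_mem_nhds 0 one_pos) fun x hx i => ?_
    rw [mem_closedBall_zero_iff] at hx
    exact (PiLp.norm_apply_le x i).trans hx
  · intro x hx i
    simpa using hx i

/-- Every symmetric convex body is up to `ε` the intersection of finitely many slabs. -/
theorem exists_finite_slabs (hP : IsSymConvexBody P) {ε : ℝ} (hε : 0 < ε) (hε1 : ε ≤ 1) :
    ∃ s : Finset E, (∀ f ∈ s, f ∈ polarSet P) ∧
      ∀ x : E, (∀ f ∈ s, |inner ℝ x f| ≤ 1) → (1 + ε)⁻¹ • x ∈ P := by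
  obtain ⟨R, hR, hPR⟩ := hP.isCompact.isBounded.subset_closedBall_lt 0 0
  -- The slabs come from an ε / (2R)-net of the polar: their intersection lies in the ball of radius
  -- 2R, so passing from the net to the whole polar costs at most ε.
  have hη : 0 < ε / (2 * R) := by positivity
  obtain ⟨t, htP, htf, htc⟩ := (isCompact_polarSet hP).finite_cover_balls hη
  refine ⟨htf.toFinset, fun f hf => htP (htf.mem_toFinset.1 hf), fun x hx => ?_⟩
  have key : ∀ g ∈ polarSet P, inner ℝ x g ≤ 1 + ‖x‖ * (ε / (2 * R)) := by
    intro g hg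
    obtain ⟨f, hf, hgf⟩ := Set.mem_iUnion₂.1 (htc hg)
    have h1 := (abs_le.1 (hx f (htf.mem_toFinset.2 hf))).2
    have h2 : inner ℝ x (g - f) ≤ ‖x‖ * (ε / (2 * R)) := by
      refine (real_inner_le_norm _ _).trans ?_
      rw [Metric.mem_ball, dist_eq_norm] at hgf
      gcongr
    rw [inner_sub_right] at h2
    linarith
  -- A priori bound: x / (R‖x‖) lies in the polar because P is in the ball of radius R. Testing
  -- `key` on it gives ‖x‖/R ≤ 1 + ‖x‖/(2R).
  have hxn : ‖x‖ ≤ 2 * R := by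
    rcases eq_or_ne x 0 with rfl | h0
    · simpa using hR.le
    have hn : 0 < ‖x‖ := norm_pos_iff.2 h0
    have h1 := key ((R * ‖x‖)⁻¹ • x) fun y hy => by
      have := mem_closedBall_zero_iff.1 (hPR hy)
      rw [real_inner_smul_right, inv_mul_le_iff₀ (by positivity), mul_one]
      exact (real_inner_le_norm _ _).trans (by gcongr)
    rw [real_inner_smul_right, real_inner_self_eq_norm_sq] at h1
    have e1 : (R * ‖x‖)⁻¹ * ‖x‖ ^ 2 = ‖x‖ / R := by field_simp
    have e2 : ‖x‖ * (ε / (2 * R)) ≤ ‖x‖ / R / 2 := by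
      have : ‖x‖ * (ε / (2 * R)) = ‖x‖ / R / 2 * ε := by field_simp
      rw [this]
      exact mul_le_of_le_one_right (by positivity) hε1
    have : ‖x‖ / R ≤ 2 := by linarith
    rwa [div_le_iff₀ hR] at this
  refine hP.mem_of_forall_polarSet fun g hg => ?_
  rw [real_inner_smul_left, inv_mul_le_iff₀ (by positivity), mul_one]
  refine (key g hg).trans ?_
  have : ‖x‖ * (ε / (2 * R)) ≤ 2 * R * (ε / (2 * R)) := by gcongr
  rw [mul_div_cancel₀ _ (by positivity)] at this
  linarith

end Body

/-! ### Representations of tensors by weakly `2`-summable families -/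

section Weak

variable {E F : Type*} [NormedAddCommGroup E] [InnerProductSpace ℝ E]
  [NormedAddCommGroup F] [InnerProductSpace ℝ F]
  {ι κ : Type*} [Fintype ι] [Fintype κ] {P : Set E}

/-- The family `a` has weak `ℓ₂`-norm at most one in the space `(E, g_P)`. -/
def WeakTwoBounded (P : Set E) (a : ι → E) : Prop :=
  ∀ f ∈ polarSet P, ∑ k, inner ℝ (a k) f ^ 2 ≤ 1

theorem WeakTwoBounded.comp_equiv {a : ι → E} (h : WeakTwoBounded P a) (e : κ ≃ ι) :
    WeakTwoBounded P (a ∘ e) := fun f hf =>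
  (Equiv.sum_comp e fun k => inner ℝ (a k) f ^ 2).trans_le (h f hf)

theorem WeakTwoBounded.subtype {a : ι → E} (h : WeakTwoBounded P a) (p : ι → Prop)
    [DecidablePred p] : WeakTwoBounded P fun k : {k // p k} => a k := fun f hf =>
  (Finset.sum_subtype (Finset.univ.filter p) (by simp) fun k => inner ℝ (a k) f ^ 2).symm.trans_le
    ((Finset.sum_le_sum_of_subset_of_nonneg (Finset.filter_subset p Finset.univ)
      fun k _ _ => sq_nonneg (inner ℝ (a k) f)).trans (h f hf))

theorem weakTwoBounded_singleton (hP : IsSymConvexBody P) {x : E} (hx : x ∈ P) :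
    WeakTwoBounded P fun _ : Unit => x := fun f hf => by
  simpa using abs_inner_le_one hP hf hx

/-- Weights enter quadratically both here and in ∑ aₖ ⊗ bₖ; with square roots, concatenation
realizes convex combinations of tensors. -/
theorem WeakTwoBounded.sumElim {a : ι → E} {b : κ → E} (ha : WeakTwoBounded P a)
    (hb : WeakTwoBounded P b) {s t : ℝ} (hs : 0 ≤ s) (ht : 0 ≤ t) (hst : s + t = 1) :
    WeakTwoBounded P (Sum.elim (fun k => √s • a k) fun k => √t • b k) := fun f hf => by
  simp only [Fintype.sum_sum_type, Sum.elim_inl, Sum.elim_inr, real_inner_smul_left, mul_pow,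
    Real.sq_sqrt hs, Real.sq_sqrt ht, ← Finset.mul_sum]
  nlinarith [ha f hf, hb f hf]

theorem WeakTwoBounded.smul {a : ι → E} (h : WeakTwoBounded P a) {t : ℝ} (ht : |t| ≤ 1) :
    WeakTwoBounded P fun k => t • a k := fun f hf => by
  simp only [real_inner_smul_left, mul_pow, ← Finset.mul_sum]
  exact mul_le_one₀ ((sq_le_one_iff_abs_le_one t).2 ht)
    (Finset.sum_nonneg fun _ _ => sq_nonneg _) (h f hf)

/-- Rotation of a finite family of vectors. -/
def rotate (w : OrthonormalBasis ι ℝ (EuclideanSpace ℝ ι)) (a : ι → E) (l : ι) : E :=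
  ∑ k, w l k • a k

theorem WeakTwoBounded.rotate {a : ι → E} (h : WeakTwoBounded P a)
    (w : OrthonormalBasis ι ℝ (EuclideanSpace ℝ ι)) : WeakTwoBounded P (rotate w a) := by
  intro f hf
  have e : ∀ l, inner ℝ (ConvexTensor.rotate w a l) f =
      inner ℝ (w l) (WithLp.toLp 2 fun k => inner ℝ (a k) f) := fun l => by
    simp [ConvexTensor.rotate, sum_inner, real_inner_smul_left, PiLp.inner_apply, mul_comm]
  simp only [e, w.sum_sq_inner_right, EuclideanSpace.real_norm_sq_eq]
  exact h f hf

/-- The rows of an orthogonal matrix being orthonormal, so are its columns. -/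
theorem sum_rotate_tmul_rotate (w : OrthonormalBasis ι ℝ (EuclideanSpace ℝ ι)) (a : ι → E)
    (b : ι → F) : ∑ l, rotate w a l ⊗ₜ[ℝ] rotate w b l = ∑ k, a k ⊗ₜ[ℝ] b k := by
  classical
  have key : ∀ k k', ∑ l, w l k * w l k' = if k = k' then 1 else 0 := fun k k' => by
    have := w.sum_inner_mul_inner (EuclideanSpace.single k 1) (EuclideanSpace.single k' 1)
    simpa [EuclideanSpace.inner_single_left, EuclideanSpace.inner_single_right, eq_comm] using this
  simp only [rotate, TensorProduct.sum_tmul, TensorProduct.tmul_sum, TensorProduct.smul_tmul_smul]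
  rw [Finset.sum_comm]
  refine Finset.sum_congr rfl fun k _ => ?_
  rw [Finset.sum_comm]
  simp only [← Finset.sum_smul, key]
  simp

/-- If `a` is linearly dependent, then some rotation of it has a vanishing entry. -/
theorem exists_rotate_eq_zero {a : ι → E} (h : ¬ LinearIndependent ℝ a) :
    ∃ (w : OrthonormalBasis ι ℝ (EuclideanSpace ℝ ι)) (l : ι), rotate w a l = 0 := by
  obtain ⟨c, hc, l, hl⟩ := Fintype.not_linearIndependent_iff.1 h
  let v : EuclideanSpace ℝ ι := WithLp.toLp 2 c
  have hv : v ≠ 0 := fun h0 => hl (by simpa using congrArg (fun x => x l) h0)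
  -- The normalized coefficient vector of a linear relation becomes row `l` of the rotation.
  obtain ⟨w, hw⟩ := Orthonormal.exists_orthonormalBasis_extension_of_card_eq (𝕜 := ℝ)
    (E := EuclideanSpace ℝ ι) (ι := ι) (by simp) (v := fun _ => ‖v‖⁻¹ • v) (s := {l}) (by
      constructor
      · intro i
        simp [Set.domRestrict, norm_smul, hv]
      · intro i j hij
        exact absurd (Subsingleton.elim i j) hij)
  refine ⟨w, l, ?_⟩
  simp only [rotate, hw l rfl, PiLp.smul_apply, smul_eq_mul, mul_smul, ← Finset.smul_sum]
  have : ∑ k, v k • a k = 0 := hc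
  rw [this, smul_zero]

variable [FiniteDimensional ℝ E]

theorem WeakTwoBounded.mem {a : ι → E} (h : WeakTwoBounded P a) (hP : IsSymConvexBody P) (k : ι) :
    a k ∈ P :=
  hP.mem_of_forall_polarSet fun f hf => (abs_le.1 ((sq_le_one_iff_abs_le_one _).1
    ((Finset.single_le_sum (f := fun k => inner ℝ (a k) f ^ 2) (fun _ _ => sq_nonneg _)
      (Finset.mem_univ k)).trans (h f hf)))).2

theorem WeakTwoBounded.map [FiniteDimensional ℝ F] {a : ι → E} (h : WeakTwoBounded P a)
    {P' : Set F} {S : E →ₗ[ℝ] F} (hS : S '' P ⊆ P') : WeakTwoBounded P' fun k => S (a k) := by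
  intro f hf
  have : S.adjoint f ∈ polarSet P := fun x hx => by
    rw [LinearMap.adjoint_inner_right]
    exact hf _ (hS ⟨x, hx, rfl⟩)
  simpa only [LinearMap.adjoint_inner_right] using h _ this

/-- Functionals in the polar of the section extend to the polar of P by Hahn–Banach, so passing to M
costs no constant. -/
theorem WeakTwoBounded.codRestrict {a : ι → E} (h : WeakTwoBounded P a) (hP : IsSymConvexBody P)
    {M : Submodule ℝ E} (hM : ∀ k, a k ∈ M) :
    WeakTwoBounded (M.subtype ⁻¹' P) fun k => (⟨a k, hM k⟩ : M) := by
  intro f hf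
  obtain ⟨g, hg, hgf⟩ := exists_polarSet_extension hP M hf
  simpa only [← hgf] using h g hg

end Weak

/-! ### The body of tensors with weakly `2`-summable representations -/

section Body

variable {E F : Type*} [NormedAddCommGroup E] [InnerProductSpace ℝ E]
  [NormedAddCommGroup F] [InnerProductSpace ℝ F] {P : Set E} {Q : Set F}

/-- The tensors `∑ aₖ ⊗ bₖ` where `a` and `b` have weak `ℓ₂`-norms at most one. -/
def weakTwoProd (P : Set E) (Q : Set F) : Set (E ⊗[ℝ] F) :=
  {u | ∃ (d : ℕ) (a : Fin d → E) (b : Fin d → F), WeakTwoBounded P a ∧ WeakTwoBounded Q b ∧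
    u = ∑ k, a k ⊗ₜ[ℝ] b k}

theorem sum_tmul_mem_weakTwoProd {ι : Type*} [Fintype ι] {a : ι → E} {b : ι → F}
    (ha : WeakTwoBounded P a) (hb : WeakTwoBounded Q b) :
    ∑ k, a k ⊗ₜ[ℝ] b k ∈ weakTwoProd P Q :=
  let e := (Fintype.equivFin ι).symm
  ⟨_, a ∘ e, b ∘ e, ha.comp_equiv e, hb.comp_equiv e,
    (Equiv.sum_comp e fun k => a k ⊗ₜ[ℝ] b k).symm⟩

theorem exists_shorter {d : ℕ} {a : Fin d → E} {b : Fin d → F} (ha : WeakTwoBounded P a)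
    (hb : WeakTwoBounded Q b) (l : Fin d) (h : a l = 0 ∨ b l = 0) :
    ∃ d' < d, ∃ (a' : Fin d' → E) (b' : Fin d' → F), WeakTwoBounded P a' ∧ WeakTwoBounded Q b' ∧
      ∑ k, a k ⊗ₜ[ℝ] b k = ∑ k, a' k ⊗ₜ[ℝ] b' k := by
  let e := (Fintype.equivFin {k // k ≠ l}).symm
  refine ⟨_, ?_, _, _, (ha.subtype (· ≠ l)).comp_equiv e, (hb.subtype (· ≠ l)).comp_equiv e, ?_⟩
  · simpa using Fintype.card_subtype_lt (p := (· ≠ l)) (x := l) (by simp)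
  · refine Eq.trans ?_ (Equiv.sum_comp e fun k => a k ⊗ₜ[ℝ] b k).symm
    rw [← Finset.add_sum_erase _ _ (Finset.mem_univ l)]
    have : a l ⊗ₜ[ℝ] b l = 0 := by rcases h with h | h <;> simp [h]
    rw [this, zero_add]
    exact Finset.sum_subtype _ (by simp) _

theorem smul_mem_weakTwoProd {u : E ⊗[ℝ] F} (hu : u ∈ weakTwoProd P Q) {t : ℝ} (ht : |t| ≤ 1) :
    t • u ∈ weakTwoProd P Q := by
  obtain ⟨d, a, b, ha, hb, rfl⟩ := hu
  refine ⟨d, _, b, ha.smul ht, hb, ?_⟩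
  simp only [Finset.smul_sum, TensorProduct.smul_tmul']

theorem convex_weakTwoProd : Convex ℝ (weakTwoProd P Q) := by
  rintro _ ⟨d, a, b, ha, hb, rfl⟩ _ ⟨d', a', b', ha', hb', rfl⟩ s t hs ht hst
  convert sum_tmul_mem_weakTwoProd (ha.sumElim ha' hs ht hst) (hb.sumElim hb' hs ht hst)
  simp only [Fintype.sum_sum_type, Sum.elim_inl, Sum.elim_inr, TensorProduct.smul_tmul_smul,
    Real.mul_self_sqrt hs, Real.mul_self_sqrt ht, Finset.smul_sum]

/-- Contracting the first factor with f ∈ Mᗮ kills M ⊗ N, so ∑ ⟨f, aₖ⟩ bₖ = 0, and independence of b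
gives aₖ ∈ Mᗮᗮ = M. -/
theorem mem_of_sum_tmul_mem_range_map [FiniteDimensional ℝ E] {M : Submodule ℝ E} {N : Submodule ℝ F} {ι : Type*}
    [Fintype ι] {a : ι → E} {b : ι → F} (hb : LinearIndependent ℝ b)
    (h : ∑ k, a k ⊗ₜ[ℝ] b k ∈ Set.range (TensorProduct.map M.subtype N.subtype)) (k : ι) :
    a k ∈ M := by
  obtain ⟨v, hv⟩ := h
  rw [← Submodule.orthogonal_orthogonal M]
  intro f hf
  have h0 : ∀ v : M ⊗[ℝ] N, tensorOperator (TensorProduct.map M.subtype N.subtype v)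
      (innerₛₗ ℝ f) = 0 := by
    intro v
    induction v using TensorProduct.induction_on with
    | zero => simp [tensorOperator]
    | tmul x y =>
      have : inner ℝ f (x : E) = 0 := Submodule.inner_left_of_mem_orthogonal x.2 hf
      simp [tensorOperator, this]
    | add x y hx hy =>
      simp only [tensorOperator, map_add, LinearMap.add_apply] at hx hy ⊢
      rw [hx, hy, add_zero]
  have h1 := h0 v
  rw [hv, tensorOperator_sum] at h1
  exact Fintype.linearIndependent_iff.1 hb _ h1 k

/-- Each element of `weakTwoProd P Q` has a representation by linearly independent families. -/
theorem exists_linearIndependent_of_mem_weakTwoProd {u : E ⊗[ℝ] F} (hu : u ∈ weakTwoProd P Q) :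
    ∃ (d : ℕ) (a : Fin d → E) (b : Fin d → F), WeakTwoBounded P a ∧ WeakTwoBounded Q b ∧
      u = ∑ k, a k ⊗ₜ[ℝ] b k ∧ LinearIndependent ℝ a ∧ LinearIndependent ℝ b := by
  classical
  -- A representation of minimal length: a linear relation in either family would allow rotating one
  -- entry to zero and dropping it.
  obtain ⟨a, b, ha, hb, hab⟩ := Nat.find_spec hu
  refine ⟨_, a, b, ha, hb, hab, ?_, ?_⟩ <;> by_contra hdep <;>
    obtain ⟨w, l, hl⟩ := exists_rotate_eq_zero hdep
  · obtain ⟨d', hd', a', b', ha', hb', h⟩ := exists_shorter (ha.rotate w) (hb.rotate w) l (.inl hl)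
    exact Nat.find_min hu hd' ⟨a', b', ha', hb', by rw [hab, ← h, sum_rotate_tmul_rotate]⟩
  · obtain ⟨d', hd', a', b', ha', hb', h⟩ := exists_shorter (ha.rotate w) (hb.rotate w) l (.inr hl)
    exact Nat.find_min hu hd' ⟨a', b', ha', hb', by rw [hab, ← h, sum_rotate_tmul_rotate]⟩

theorem tmul_mem_weakTwoProd (hP : IsSymConvexBody P) (hQ : IsSymConvexBody Q) {x : E} {y : F}
    (hx : x ∈ P) (hy : y ∈ Q) : x ⊗ₜ[ℝ] y ∈ weakTwoProd P Q := by
  simpa using sum_tmul_mem_weakTwoProd (weakTwoBounded_singleton hP hx)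
    (weakTwoBounded_singleton hQ hy)

variable [FiniteDimensional ℝ E] [FiniteDimensional ℝ F]

/-- Linearly independent representations have length at most dim E, so finitely many continuous
images of compact sets suffice. -/
theorem isCompact_weakTwoProd (hP : IsSymConvexBody P) (hQ : IsSymConvexBody Q) :
    IsCompact (weakTwoProd P Q) := by
  let K : ∀ d : ℕ, Set ((Fin d → E) × (Fin d → F)) := fun d =>
    {p | WeakTwoBounded P p.1 ∧ WeakTwoBounded Q p.2}
  let Φ : ∀ d : ℕ, (Fin d → E) × (Fin d → F) → E ⊗[ℝ] F := fun d p => ∑ k, p.1 k ⊗ₜ[ℝ] p.2 k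
  have hK : ∀ d, IsCompact (K d) := by
    intro d
    refine ((isCompact_univ_pi fun _ => hP.isCompact).prod
      (isCompact_univ_pi fun _ => hQ.isCompact)).of_isClosed_subset ?_ ?_
    · simp only [K, WeakTwoBounded, Set.ofPred_and, Set.ofPred_forall]
      refine IsClosed.inter ?_ ?_ <;>
        exact isClosed_iInter fun f => isClosed_iInter fun _ =>
          isClosed_le (by fun_prop) continuous_const
    · rintro ⟨a, b⟩ ⟨ha, hb⟩
      exact ⟨fun k _ => ha.mem hP k, fun k _ => hb.mem hQ k⟩
  have hΦ : ∀ d, Continuous (Φ d) := by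
    intro d
    refine continuous_finsetSum _ fun k _ => ?_
    have h := (LinearMap.toContinuousBilinearMap (TensorProduct.mk ℝ E F)).continuous₂
    exact h.comp (f := fun p : (Fin d → E) × (Fin d → F) => (p.1 k, p.2 k)) (by fun_prop)
  have e : weakTwoProd P Q = ⋃ d ∈ Finset.range (Module.finrank ℝ E + 1), Φ d '' K d := by
    ext u
    simp only [Set.mem_iUnion, Finset.mem_range, Nat.lt_succ_iff]
    constructor
    · intro hu
      obtain ⟨d, a, b, ha, hb, hab, hi, -⟩ := exists_linearIndependent_of_mem_weakTwoProd hu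
      exact ⟨d, by simpa using hi.fintype_card_le_finrank, (a, b), ⟨ha, hb⟩, hab.symm⟩
    · rintro ⟨d, -, ⟨a, b⟩, ⟨ha, hb⟩, rfl⟩
      exact ⟨d, a, b, ha, hb, rfl⟩
  rw [e]
  exact Finset.isCompact_biUnion _ fun d _ => (hK d).image (hΦ d)

theorem projProd_subset_weakTwoProd {E F : Type u} [NormedAddCommGroup E] [InnerProductSpace ℝ E]
    [FiniteDimensional ℝ E] [NormedAddCommGroup F] [InnerProductSpace ℝ F] [FiniteDimensional ℝ F]
    {P : Set E} {Q : Set F} (hP : IsSymConvexBody P) (hQ : IsSymConvexBody Q) :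
    projProd E F P Q ⊆ weakTwoProd P Q := by
  refine convexHull_min ?_ convex_weakTwoProd
  rintro _ ⟨x, hx, y, hy, rfl⟩
  simpa using sum_tmul_mem_weakTwoProd (weakTwoBounded_singleton hP hx)
    (weakTwoBounded_singleton hQ hy)

theorem weakTwoProd_subset_injProd {E F : Type u} [NormedAddCommGroup E] [InnerProductSpace ℝ E]
    [FiniteDimensional ℝ E] [NormedAddCommGroup F] [InnerProductSpace ℝ F] [FiniteDimensional ℝ F]
    (P : Set E) (Q : Set F) : weakTwoProd P Q ⊆ injProd E F P Q := by
  rintro _ ⟨d, a, b, ha, hb, rfl⟩ z hz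
  refine convexHull_min (t := {z | inner ℝ z (∑ k, a k ⊗ₜ[ℝ] b k) ≤ 1}) ?_ ?_ hz
  · rintro _ ⟨f, hf, g, hg, rfl⟩
    simp only [Set.mem_ofPred_eq, inner_sum, TensorProduct.inner_tmul]
    have : ∀ k ∈ Finset.univ, inner ℝ f (a k) * inner ℝ g (b k) ≤
        (inner ℝ (a k) f ^ 2 + inner ℝ (b k) g ^ 2) / 2 := fun k _ => by
      rw [real_inner_comm, real_inner_comm (b k) g]
      nlinarith [sq_nonneg (inner ℝ (a k) f - inner ℝ (b k) g)]
    refine (Finset.sum_le_sum this).trans ?_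
    rw [← Finset.sum_div, Finset.sum_add_distrib]
    linarith [ha f hf, hb g hg]
  · intro x hx y hy s t hs ht hst
    simp only [Set.mem_ofPred_eq, inner_add_left, real_inner_smul_left] at *
    nlinarith

theorem isSymConvexBody_weakTwoProd (hP : IsSymConvexBody P) (hQ : IsSymConvexBody Q) :
    IsSymConvexBody (weakTwoProd P Q) where
  convex := convex_weakTwoProd
  isCompact := isCompact_weakTwoProd hP hQ
  neg_eq := by
    ext u
    constructor <;> intro h
    · simpa using smul_mem_weakTwoProd h (t := -1) (by simp)
    · simpa using smul_mem_weakTwoProd h (t := -1) (by simp)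
  interior_nonempty := by
    -- It suffices that the set contains 0 and spans, which holds since P and Q are absorbing.
    rw [convex_weakTwoProd.interior_nonempty_iff_affineSpan_eq_top]
    have h0 : (0 : E ⊗[ℝ] F) ∈ weakTwoProd P Q := by
      simpa using tmul_mem_weakTwoProd hP hQ hP.zero_mem hQ.zero_mem
    rw [← Set.insert_eq_of_mem h0]
    suffices Submodule.span ℝ (weakTwoProd P Q) = ⊤ from
      SetLike.coe_injective (by rw [affineSpan_insert_zero, this]; rfl)
    rw [eq_top_iff, ← TensorProduct.span_tmul_eq_top, Submodule.span_le]
    rintro _ ⟨x, y, rfl⟩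
    obtain ⟨s, x', hx', rfl⟩ := hP.exists_eq_smul x
    obtain ⟨t, y', hy', rfl⟩ := hQ.exists_eq_smul y
    rw [TensorProduct.smul_tmul_smul]
    exact Submodule.smul_mem _ _ (Submodule.subset_span (tmul_mem_weakTwoProd hP hQ hx' hy'))

theorem map_image_weakTwoProd_subset {E' F' : Type*}
    [NormedAddCommGroup E'] [InnerProductSpace ℝ E'] [FiniteDimensional ℝ E']
    [NormedAddCommGroup F'] [InnerProductSpace ℝ F'] [FiniteDimensional ℝ F']
    {P' : Set E'} {Q' : Set F'} {S : E →ₗ[ℝ] E'} {T : F →ₗ[ℝ] F'} (hS : S '' P ⊆ P')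
    (hT : T '' Q ⊆ Q') : TensorProduct.map S T '' weakTwoProd P Q ⊆ weakTwoProd P' Q' := by
  rintro _ ⟨_, ⟨d, a, b, ha, hb, rfl⟩, rfl⟩
  exact ⟨d, _, _, ha.map hS, hb.map hT, by simp⟩

theorem weakTwoProd_section (hP : IsSymConvexBody P) (hQ : IsSymConvexBody Q)
    (M : Submodule ℝ E) (N : Submodule ℝ F) :
    TensorProduct.map M.subtype N.subtype '' weakTwoProd (M.subtype ⁻¹' P) (N.subtype ⁻¹' Q) =
      weakTwoProd P Q ∩ Set.range (TensorProduct.map M.subtype N.subtype) := by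
  refine Set.Subset.antisymm (Set.subset_inter (map_image_weakTwoProd_subset
    (Set.image_preimage_subset _ _) (Set.image_preimage_subset _ _))
    (Set.image_subset_range _ _)) ?_
  rintro u ⟨hu, hr⟩
  obtain ⟨d, a, b, ha, hb, rfl, hai, hbi⟩ := exists_linearIndependent_of_mem_weakTwoProd hu
  have haM := mem_of_sum_tmul_mem_range_map hbi hr
  have hbN : ∀ k, b k ∈ N := by
    -- The same argument after swapping the two tensor factors.
    refine mem_of_sum_tmul_mem_range_map (N := M) hai ?_
    obtain ⟨v, hv⟩ := hr
    refine ⟨TensorProduct.comm ℝ M N v, ?_⟩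
    rw [TensorProduct.map_comm, hv]
    simp
  exact ⟨_, sum_tmul_mem_weakTwoProd (ha.codRestrict hP haM) (hb.codRestrict hQ hbN), by simp⟩

end Body

/-! ### The Hilbertian tensor product -/

section OpNorm

variable {V W : Type*} [AddCommGroup V] [Module ℝ V] [AddCommGroup W] [Module ℝ W]
  {p : V → ℝ} {q : W → ℝ} {T : V →ₗ[ℝ] W}

theorem opNormFor_nonneg : 0 ≤ opNormFor p q T := Real.sInf_nonneg fun _ hc => hc.1

theorem opNormFor_le {c : ℝ} (hc : 0 ≤ c) (h : ∀ v, q (T v) ≤ c * p v) : opNormFor p q T ≤ c :=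
  csInf_le ⟨0, fun _ hc => hc.1⟩ ⟨hc, h⟩

/-- Boundedness is essential: the infimum over an empty set of constants would be 0. -/
theorem IsBoundedFor.le_opNormFor_mul (h : IsBoundedFor p q T) {v : V} (hv : 0 ≤ p v) :
    q (T v) ≤ opNormFor p q T * p v := by
  rcases hv.eq_or_lt with h0 | h0
  · obtain ⟨c, -, hc⟩ := h
    simpa [← h0] using hc v
  · rw [← div_le_iff₀ h0]
    exact le_csInf h fun c hc => (div_le_iff₀ h0).2 (hc.2 v)

end OpNorm

section Dual

variable {E : Type*} [NormedAddCommGroup E] [InnerProductSpace ℝ E] {P : Set E}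

theorem abs_inner_le_mul_gauge (hP : IsSymConvexBody P) {f : E} {t : ℝ}
    (h : ∀ x ∈ P, |inner ℝ x f| ≤ t) (x : E) : |inner ℝ x f| ≤ t * gauge P x := by
  rw [abs_le']
  refine ⟨hP.inner_le_mul_gauge (fun y hy => (abs_le'.1 (h y hy)).1) x, ?_⟩
  rw [← inner_neg_right]
  refine hP.inner_le_mul_gauge (fun y hy => ?_) x
  rw [inner_neg_right]
  exact (abs_le'.1 (h y hy)).2

theorem dualGauge_innerₛₗ_le_one (hP : IsSymConvexBody P) {f : E} (hf : f ∈ polarSet P) :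
    dualGauge P (innerₛₗ ℝ f) ≤ 1 :=
  opNormFor_le zero_le_one fun x => by
    rw [innerₛₗ_apply_apply, real_inner_comm]
    exact abs_inner_le_mul_gauge hP (fun y hy => abs_inner_le_one hP hf hy) x

variable [FiniteDimensional ℝ E]

theorem exists_eq_innerₛₗ (φ : Module.Dual ℝ E) : ∃ f : E, φ = innerₛₗ ℝ f :=
  ⟨(InnerProductSpace.toDual ℝ E).symm (LinearMap.toContinuousLinearMap φ), by
    ext x
    exact (InnerProductSpace.toDual_symm_apply (x := x)
      (y := LinearMap.toContinuousLinearMap φ)).symm⟩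

theorem abs_le_dualGauge (hP : IsSymConvexBody P) (φ : Module.Dual ℝ E) {x : E} (hx : x ∈ P) :
    |φ x| ≤ dualGauge P φ := by
  obtain ⟨f, rfl⟩ := exists_eq_innerₛₗ φ
  obtain ⟨R, hR, hPR⟩ := hP.isCompact.isBounded.subset_closedBall_lt 0 0
  have hb : IsBoundedFor (gauge P) (fun t : ℝ => |t|) (innerₛₗ ℝ f : E →ₗ[ℝ] ℝ) :=
    ⟨R * ‖f‖, by positivity, fun x => by
      rw [innerₛₗ_apply_apply, real_inner_comm]
      exact abs_inner_le_mul_gauge hP (fun y hy => (abs_real_inner_le_norm _ _).trans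
        (by have := mem_closedBall_zero_iff.1 (hPR hy); gcongr)) x⟩
  refine (hb.le_opNormFor_mul (gauge_nonneg x)).trans ?_
  exact mul_le_of_le_one_right opNormFor_nonneg (hP.gauge_le_one_iff.2 hx)

theorem WeakTwoBounded.sum_sq_le {ι : Type*} [Fintype ι] {a : ι → E} (h : WeakTwoBounded P a)
    (hP : IsSymConvexBody P) (φ : Module.Dual ℝ E) :
    ∑ k, φ (a k) ^ 2 ≤ dualGauge P φ ^ 2 := by
  obtain ⟨f, hf⟩ := exists_eq_innerₛₗ φ
  have h0 : 0 ≤ dualGauge P φ := opNormFor_nonneg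
  -- Scaling by t > `dualGauge P φ` and letting t decrease avoids dividing by a dual norm that may
  -- vanish.
  have key : ∀ t, dualGauge P φ < t → ∑ k, φ (a k) ^ 2 ≤ t ^ 2 := by
    intro t ht
    have ht0 : 0 < t := h0.trans_lt ht
    have := h (t⁻¹ • f) fun x hx => by
      rw [real_inner_smul_right, inv_mul_le_iff₀ ht0, mul_one, real_inner_comm,
        ← innerₛₗ_apply_apply, ← hf]
      exact (le_abs_self _).trans ((abs_le_dualGauge hP φ hx).trans ht.le)
    simp only [real_inner_smul_right, mul_pow, ← Finset.mul_sum, inv_pow] at this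
    rw [inv_mul_le_iff₀ (by positivity), mul_one] at this
    rw [hf]
    simpa only [innerₛₗ_apply_apply, real_inner_comm] using this
  have hlim : Filter.Tendsto (fun s : ℝ => s ^ 2)
      (nhdsWithin (dualGauge P φ) (Set.Ioi (dualGauge P φ)))
      (nhds (dualGauge P φ ^ 2)) := (continuous_pow 2).continuousWithinAt
  exact ge_of_tendsto hlim (Filter.eventually_of_mem self_mem_nhdsWithin key)

end Dual

/-! ### Hilbert space factorizations as weakly `2`-summable representations -/

section Operator

variable {E F : Type*} [NormedAddCommGroup E] [InnerProductSpace ℝ E]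
  [NormedAddCommGroup F] [InnerProductSpace ℝ F] {P : Set E} {Q : Set F}

theorem tensorOperator_smul (t : ℝ) (u : E ⊗[ℝ] F) :
    tensorOperator (t • u) = t • tensorOperator u := by
  simp [tensorOperator]

variable [FiniteDimensional ℝ E]

theorem tensorOperator_injective :
    Function.Injective (tensorOperator : E ⊗[ℝ] F → Module.Dual ℝ E →ₗ[ℝ] F) := by
  intro u v h
  have h1 := (dualTensorHomEquiv ℝ (Module.Dual ℝ E) F).injective h
  exact (TensorProduct.congr (Module.evalEquiv ℝ E) (LinearEquiv.refl ℝ F)).injective h1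

/-- With an orthonormal basis v of the range of S, expanding Sφ gives T_u φ = ∑ ⟨vₗ, Sφ⟩ R vₗ.
Parseval turns ‖S‖ into the weak norm of the first family, duality turns ‖R‖ into that of the
second. -/
theorem inv_smul_mem_weakTwoProd (hP : IsSymConvexBody P) (hQ : IsSymConvexBody Q) {u : E ⊗[ℝ] F}
    {H : Type*} [NormedAddCommGroup H] [InnerProductSpace ℝ H] {S : Module.Dual ℝ E →ₗ[ℝ] H}
    {R : H →ₗ[ℝ] F} {r s : ℝ} (hs : 0 < s) (hr : 0 < r)
    (hS : ∀ φ, ‖S φ‖ ≤ s * dualGauge P φ) (hR : ∀ h, gauge Q (R h) ≤ r * ‖h‖)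
    (hu : R ∘ₗ S = tensorOperator u) : (r * s)⁻¹ • u ∈ weakTwoProd P Q := by
  let v := stdOrthonormalBasis ℝ (LinearMap.range S)
  let a := fun l => (Module.evalEquiv ℝ E).symm (innerₛₗ ℝ (v l : H) ∘ₗ S)
  let b := fun l => R (v l)
  have ha : ∀ l φ, φ (a l) = inner ℝ (v l : H) (S φ) := fun l φ => by
    simp [a]
  have hua : u = ∑ l, a l ⊗ₜ[ℝ] b l := by
    refine tensorOperator_injective (LinearMap.ext fun φ => ?_)
    rw [tensorOperator_sum, ← hu]
    simp only [ha, b, LinearMap.comp_apply, ← map_smul, ← map_sum]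
    congr 1
    have := congrArg Subtype.val (v.sum_repr' ⟨S φ, φ, rfl⟩)
    simpa using this.symm
  have ha2 : WeakTwoBounded P fun l => s⁻¹ • a l := by
    intro f hf
    have h1 := hS (innerₛₗ ℝ f)
    have h2 : ‖S (innerₛₗ ℝ f)‖ ≤ s :=
      h1.trans (mul_le_of_le_one_right hs.le (dualGauge_innerₛₗ_le_one hP hf))
    have h3 : ∑ l, inner ℝ (a l) f ^ 2 = ‖S (innerₛₗ ℝ f)‖ ^ 2 := by
      have h4 := v.sum_sq_inner_right ⟨S (innerₛₗ ℝ f), _, rfl⟩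
      have h5 : ∀ l, inner ℝ (a l) f = inner ℝ (v l : H) (S (innerₛₗ ℝ f)) := fun l => by
        rw [← ha, innerₛₗ_apply_apply, real_inner_comm]
      simp only [h5]
      exact h4
    simp only [real_inner_smul_left, mul_pow, ← Finset.mul_sum, h3, inv_pow]
    rw [inv_mul_le_iff₀ (by positivity), mul_one]
    gcongr
  have hb2 : WeakTwoBounded Q fun l => r⁻¹ • b l := by
    intro g hg
    -- The vector that attains the ℓ₂-norm of (⟨bₗ, g⟩): then ‖h‖² = ⟨R h, g⟩ ≤ r‖h‖.
    let h : LinearMap.range S := ∑ l, inner ℝ (b l) g • v l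
    have h1 : ‖h‖ ^ 2 = ∑ l, inner ℝ (b l) g ^ 2 := by
      rw [← v.sum_sq_inner_right h]
      refine Finset.sum_congr rfl fun l _ => ?_
      rw [v.orthonormal.inner_right_fintype]
    have h2 : inner ℝ (R h) g = ‖h‖ ^ 2 := by
      rw [h1]
      simp [h, sum_inner, real_inner_smul_left, sq, b]
    have h3 : inner ℝ (R h) g ≤ 1 * gauge Q (R h) := hQ.inner_le_mul_gauge hg _
    have h4 : ‖h‖ ^ 2 ≤ r * ‖h‖ := by
      rw [← h2]
      exact h3.trans (by simpa using hR h)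
    have h5 : ‖h‖ ≤ r := by
      by_contra hlt
      push Not at hlt
      nlinarith
    simp only [real_inner_smul_left, mul_pow, ← Finset.mul_sum, ← h1, inv_pow]
    rw [inv_mul_le_iff₀ (by positivity), mul_one]
    gcongr
  have := sum_tmul_mem_weakTwoProd ha2 hb2
  simp only [TensorProduct.smul_tmul_smul, ← Finset.smul_sum, ← hua] at this
  rwa [mul_inv, mul_comm]

variable [FiniteDimensional ℝ F]

/-- If `u` is a multiple of a tensor in `weakTwoProd P Q`, then `T_u` factors through a Hilbert
space, with control of the norms. -/
theorem exists_factorization (hP : IsSymConvexBody P) (hQ : IsSymConvexBody Q) {u : E ⊗[ℝ] F}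
    (hu : u ∈ weakTwoProd P Q) (t : ℝ) :
    ∃ c ≤ |t|, ∃ (H : Type) (_ : NormedAddCommGroup H) (_ : InnerProductSpace ℝ H)
      (_ : CompleteSpace H) (S : Module.Dual ℝ E →ₗ[ℝ] H) (R : H →ₗ[ℝ] F),
      IsBoundedFor (dualGauge P) (fun h => ‖h‖) S ∧ IsBoundedFor (fun h => ‖h‖) (gauge Q) R ∧
      R ∘ₗ S = tensorOperator (t • u) ∧
      c = opNormFor (fun h => ‖h‖) (gauge Q) R * opNormFor (dualGauge P) (fun h => ‖h‖) S := by
  obtain ⟨d, a, b, ha, hb, rfl⟩ := hu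
  let S : Module.Dual ℝ E →ₗ[ℝ] EuclideanSpace ℝ (Fin d) :=
    t • ((WithLp.linearEquiv 2 ℝ (Fin d → ℝ)).symm.toLinearMap ∘ₗ
      LinearMap.pi fun k => Module.Dual.eval ℝ E (a k))
  let R : EuclideanSpace ℝ (Fin d) →ₗ[ℝ] F :=
    ∑ k, (EuclideanSpace.proj (𝕜 := ℝ) k).toLinearMap.smulRight (b k)
  have hSk : ∀ φ k, S φ k = t * φ (a k) := fun φ k => by simp [S]
  have hR' : ∀ h, R h = ∑ k, h k • b k := fun h => by simp [R]
  have hS : ∀ φ, ‖S φ‖ ≤ |t| * dualGauge P φ := by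
    intro φ
    refine le_of_sq_le_sq ?_ (mul_nonneg (abs_nonneg t) opNormFor_nonneg)
    simp only [EuclideanSpace.real_norm_sq_eq, hSk, mul_pow, ← Finset.mul_sum, sq_abs]
    gcongr
    exact ha.sum_sq_le hP φ
  have hR : ∀ h, gauge Q (R h) ≤ 1 * ‖h‖ := by
    intro h
    rw [one_mul]
    refine le_of_forall_gt_imp_ge_of_dense fun s hs => ?_
    have hs0 : 0 < s := (norm_nonneg h).trans_lt hs
    rw [hQ.gauge_le_iff hs0]
    refine hQ.mem_of_forall_polarSet fun g hg => ?_
    rw [real_inner_smul_left, inv_mul_le_iff₀ hs0, mul_one, hR', sum_inner]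
    simp only [real_inner_smul_left]
    refine (Real.sum_mul_le_sqrt_mul_sqrt _ _ _).trans ?_
    rw [← EuclideanSpace.real_norm_sq_eq, Real.sqrt_sq (norm_nonneg h)]
    have := Real.sqrt_le_one.2 (hb g hg)
    nlinarith [norm_nonneg h]
  refine ⟨_, ?_, _, inferInstance, inferInstance, inferInstance, S, R, ⟨_, abs_nonneg t, hS⟩,
    ⟨1, zero_le_one, hR⟩, ?_, rfl⟩
  · have h1 := opNormFor_le zero_le_one hR
    have h2 := opNormFor_le (abs_nonneg t) hS
    calc _ ≤ 1 * |t| := mul_le_mul h1 h2 opNormFor_nonneg zero_le_one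
      _ = |t| := one_mul _
  · ext φ
    rw [tensorOperator_smul, LinearMap.smul_apply, tensorOperator_sum, LinearMap.comp_apply, hR',
      Finset.smul_sum]
    simp only [hSk, mul_smul]

theorem hilbertianNorm_le_one_iff (hP : IsSymConvexBody P) (hQ : IsSymConvexBody Q)
    {u : E ⊗[ℝ] F} : hilbertianNorm P Q u ≤ 1 ↔ u ∈ weakTwoProd P Q := by
  constructor
  · intro h
    -- Some factorization must exist before the infimum can be used, since an empty infimum is 0;
    -- `weakTwoProd` is absorbing, so u is a multiple of one of its elements.
    obtain ⟨t, u', hu', hut⟩ := (isSymConvexBody_weakTwoProd hP hQ).exists_eq_smul u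
    obtain ⟨c₀, -, hc₀⟩ := exists_factorization hP hQ hu' t
    rw [← hut] at hc₀
    refine (isCompact_weakTwoProd hP hQ).isClosed.mem_of_forall_inv_pow_smul_mem 1
      fun ε hε _ => ?_
    obtain ⟨c, ⟨H, _, _, _, S, R, hS, hR, hRS, rfl⟩, hc⟩ :=
      exists_lt_of_csInf_lt ⟨c₀, hc₀⟩ (h.trans_lt (lt_add_of_pos_right 1 hε))
    set r := opNormFor (fun h => ‖h‖) (gauge Q) R with hr
    set s := opNormFor (dualGauge P) (fun h => ‖h‖) S with hs
    have hr0 : 0 ≤ r := opNormFor_nonneg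
    have hs0 : 0 ≤ s := opNormFor_nonneg
    -- The norms r and s may vanish; adding a small δ makes them positive while the product stays
    -- below 1 + ε.
    have hlim : Filter.Tendsto (fun δ : ℝ => (r + δ) * (s + δ)) (nhdsWithin 0 (Set.Ioi 0))
        (nhds (r * s)) := by
      have : Continuous fun δ : ℝ => (r + δ) * (s + δ) := by fun_prop
      simpa using (this.continuousWithinAt (x := 0) (s := Set.Ioi 0)).tendsto
    obtain ⟨δ, hδ, hδ0⟩ := ((hlim.eventually_lt_const hc).and self_mem_nhdsWithin).exists
    have hδ0 : 0 < δ := hδ0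
    have hrp : 0 < r + δ := by linarith
    have hsp : 0 < s + δ := by linarith
    have key := inv_smul_mem_weakTwoProd hP hQ hsp hrp
      (fun φ => (hS.le_opNormFor_mul opNormFor_nonneg).trans
        (mul_le_mul_of_nonneg_right (by linarith) opNormFor_nonneg))
      (fun h => (hR.le_opNormFor_mul (norm_nonneg h)).trans
        (mul_le_mul_of_nonneg_right (by linarith) (norm_nonneg h))) hRS
    have hp : 0 < (r + δ) * (s + δ) := mul_pos hrp hsp
    have := smul_mem_weakTwoProd key (t := (1 + ε)⁻¹ * ((r + δ) * (s + δ))) (by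
      rw [abs_of_pos (by positivity), inv_mul_le_iff₀ (by positivity), mul_one]
      exact hδ.le)
    rwa [smul_smul, mul_assoc, mul_inv_cancel₀ hp.ne', mul_one, ← pow_one (1 + ε)⁻¹] at this
  · intro h
    obtain ⟨c, hc, hmem⟩ := exists_factorization hP hQ h 1
    rw [one_smul] at hmem
    refine le_trans (b := c) (csInf_le ⟨0, ?_⟩ hmem) (by simpa using hc)
    rintro _ ⟨H, _, _, _, S, R, -, -, -, rfl⟩
    exact mul_nonneg opNormFor_nonneg opNormFor_nonneg

end Operator

section Product

theorem hilbertianProd_eq {E F : Type u}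
    [NormedAddCommGroup E] [InnerProductSpace ℝ E] [FiniteDimensional ℝ E]
    [NormedAddCommGroup F] [InnerProductSpace ℝ F] [FiniteDimensional ℝ F]
    {P : Set E} {Q : Set F} (hP : IsSymConvexBody P) (hQ : IsSymConvexBody Q) :
    hilbertianProd E F P Q = weakTwoProd P Q :=
  Set.ext fun _ => hilbertianNorm_le_one_iff hP hQ

theorem isTensorProduct_hilbertianProd : IsTensorProduct hilbertianProd.{u} where
  isSymConvexBody E F _ _ _ _ _ _ P Q hP hQ := by
    rw [hilbertianProd_eq hP hQ]
    exact isSymConvexBody_weakTwoProd hP hQ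
  proj_subset E F _ _ _ _ _ _ P Q hP hQ := by
    rw [hilbertianProd_eq hP hQ]
    exact projProd_subset_weakTwoProd hP hQ
  subset_inj E F _ _ _ _ _ _ P Q hP hQ := by
    rw [hilbertianProd_eq hP hQ]
    exact weakTwoProd_subset_injProd P Q
  uniform E F E' F' _ _ _ _ _ _ _ _ _ _ _ _ P Q P' Q' hP hQ hP' hQ' S T hS hT := by
    rw [hilbertianProd_eq hP hQ, hilbertianProd_eq hP' hQ']
    exact map_image_weakTwoProd_subset hS hT

theorem isInjective_hilbertianProd : IsInjective hilbertianProd.{u} := by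
  intro E F _ _ _ _ _ _ P Q hP hQ M N
  rw [hilbertianProd_eq hP hQ,
    hilbertianProd_eq (hP.preimage_subtype M) (hQ.preimage_subtype N)]
  exact weakTwoProd_section hP hQ M N

/-! ### Comparison with the injective tensor products -/

/-- Grothendieck's inequality for matrices and families of vectors with arbitrary index sets. -/
theorem abs_sum_inner_le {ι κ : Type*} [Fintype ι] [Fintype κ] (a : ι → κ → ℝ)
    (ha : ∀ (s : ι → ℝ) (t : κ → ℝ), (∀ i, |s i| ≤ 1) → (∀ j, |t j| ≤ 1) →
      |∑ i, ∑ j, a i j * (s i * t j)| ≤ 1)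
    {H : Type} [NormedAddCommGroup H] [InnerProductSpace ℝ H] [CompleteSpace H]
    (x : ι → H) (y : κ → H) (hx : ∀ i, ‖x i‖ ≤ 1) (hy : ∀ j, ‖y j‖ ≤ 1) :
    |∑ i, ∑ j, a i j * inner ℝ (x i) (y j)| ≤ grothendieckConstant := by
  let e := Fintype.equivFin ι
  let e' := Fintype.equivFin κ
  have key : ∀ c : ι → κ → ℝ, ∑ i, ∑ j, c (e.symm i) (e'.symm j) = ∑ i, ∑ j, c i j := fun c => by
    rw [Equiv.sum_comp e.symm fun i => ∑ j, c i (e'.symm j)]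
    exact Finset.sum_congr rfl fun i _ => Equiv.sum_comp e'.symm (c i)
  have := isLeast_grothendieckConstant.1 _ _ (fun i j => a (e.symm i) (e'.symm j))
    (fun s t hs ht => by
      have := ha (s ∘ e) (t ∘ e') (fun i => hs _) (fun j => ht _)
      rw [← key] at this
      simpa using this) H (x ∘ e.symm) (y ∘ e'.symm) (fun i => hx _) (fun j => hy _)
  rw [← key]
  exact this

/-- The map into `ℓ_∞` given by finitely many vectors. -/
def slabMap {E : Type*} [NormedAddCommGroup E] [InnerProductSpace ℝ E] (s : Finset E) :
    E →ₗ[ℝ] EuclideanSpace ℝ s :=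
  (WithLp.linearEquiv 2 ℝ (s → ℝ)).symm.toLinearMap ∘ₗ
    LinearMap.pi fun f : s => (innerₛₗ ℝ (f : E) : E →ₗ[ℝ] ℝ)

theorem slabMap_apply {E : Type*} [NormedAddCommGroup E] [InnerProductSpace ℝ E] (s : Finset E)
    (x : E) (f : s) : slabMap s x f = inner ℝ x (f : E) := by
  simp [slabMap, real_inner_comm]

theorem ker_slabMap {E : Type*} [NormedAddCommGroup E] [InnerProductSpace ℝ E] {P : Set E}
    (hP : IsSymConvexBody P) {s : Finset E} {t : ℝ} (ht : t ≠ 0)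
    (hs : ∀ x : E, (∀ f ∈ s, |inner ℝ x f| ≤ 1) → t • x ∈ P) :
    LinearMap.ker (slabMap s) = ⊥ := by
  rw [LinearMap.ker_eq_bot']
  intro x hx
  obtain ⟨R, hR, hPR⟩ := hP.isCompact.isBounded.subset_closedBall_lt 0 0
  by_contra h0
  have hn : 0 < ‖t • x‖ := norm_pos_iff.2 (smul_ne_zero ht h0)
  -- Every multiple of a kernel vector satisfies all slab inequalities; this one would put a vector
  -- of norm R + 1 into P.
  have h1 := hs (((R + 1) / ‖t • x‖) • x) fun f hf => by
    rw [real_inner_smul_left, ← slabMap_apply s x ⟨f, hf⟩, hx]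
    simp
  have h2 := mem_closedBall_zero_iff.1 (hPR h1)
  rw [smul_comm, norm_smul, norm_div, norm_norm, div_mul_cancel₀ _ hn.ne', Real.norm_eq_abs,
    abs_of_pos (by linarith)] at h2
  linarith

variable {E F : Type u}
  [NormedAddCommGroup E] [InnerProductSpace ℝ E] [NormedAddCommGroup F] [InnerProductSpace ℝ F]
  {P : Set E} {Q : Set F}

/-- Grothendieck's theorem: on cubes, the Hilbertian tensor product is, up to the constant, inside
of every tensor product. -/
theorem inv_smul_map_slabMap_mem {β : BodyProduct.{u}} (hβ : IsTensorProduct β)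
    {s : Finset E} (hs : ∀ f ∈ s, f ∈ polarSet P) {t : Finset F} (ht : ∀ g ∈ t, g ∈ polarSet Q)
    {u : E ⊗[ℝ] F} (hu : u ∈ weakTwoProd P Q) :
    grothendieckConstant⁻¹ • TensorProduct.map (slabMap s) (slabMap t) u ∈
      β _ _ (cube s) (cube t) := by
  classical
  have hs' := isSymConvexBody_cube s
  have ht' := isSymConvexBody_cube t
  have hB := hβ.isSymConvexBody _ _ _ _ hs' ht'
  have hK : 0 < grothendieckConstant := one_pos.trans_le one_le_grothendieckConstant
  by_contra hnot
  obtain ⟨Φ, c, h1, h2⟩ := geometric_hahn_banach_closed_point hB.convex hB.isCompact.isClosed hnot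
  have hc : 0 < c := by simpa using h1 0 hB.zero_mem
  obtain ⟨d, a, b, ha, hb, rfl⟩ := hu
  -- The separating functional, normalized to be at most 1 on β of the cubes, hence on their
  -- projective product.
  let A : s → t → ℝ := fun i j =>
    c⁻¹ * Φ (EuclideanSpace.single i 1 ⊗ₜ[ℝ] EuclideanSpace.single j 1)
  have hA : ∀ (x : EuclideanSpace ℝ s) (y : EuclideanSpace ℝ t),
      c⁻¹ * Φ (x ⊗ₜ[ℝ] y) = ∑ i, ∑ j, A i j * (x i * y j) := by
    intro x y
    conv_lhs => rw [← (EuclideanSpace.basisFun s ℝ).sum_repr x,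
      ← (EuclideanSpace.basisFun t ℝ).sum_repr y]
    simp only [TensorProduct.sum_tmul, TensorProduct.tmul_sum, map_sum, Finset.mul_sum,
      TensorProduct.smul_tmul_smul, map_smul, smul_eq_mul, EuclideanSpace.basisFun_apply,
      EuclideanSpace.basisFun_repr, A]
    rw [Finset.sum_comm]
    exact Finset.sum_congr rfl fun i _ => Finset.sum_congr rfl fun j _ => by ring
  have hA1 : ∀ (x : s → ℝ) (y : t → ℝ), (∀ i, |x i| ≤ 1) → (∀ j, |y j| ≤ 1) →
      |∑ i, ∑ j, A i j * (x i * y j)| ≤ 1 := by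
    intro x y hx hy
    have key : ∀ x : s → ℝ, (∀ i, |x i| ≤ 1) → ∑ i, ∑ j, A i j * (x i * y j) ≤ 1 := by
      intro x hx
      have := hA (WithLp.toLp 2 x) (WithLp.toLp 2 y)
      simp only at this
      rw [← this, inv_mul_le_iff₀ hc, mul_one]
      exact (h1 _ (hβ.proj_subset _ _ _ _ hs' ht'
        (subset_convexHull ℝ _ ⟨_, hx, _, hy, rfl⟩))).le
    rw [abs_le']
    refine ⟨key x hx, ?_⟩
    have := key (fun i => -x i) (by simpa using hx)
    simpa using this
  -- The vectors (⟨aₖ, f⟩)ₖ and (⟨bₖ, g⟩)ₖ lie in the unit ball exactly by the weak ℓ₂ bounds, since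
  -- f ∈ P° and g ∈ Q°.
  have hG := abs_sum_inner_le A hA1 (H := EuclideanSpace ℝ (Fin d))
    (fun f => WithLp.toLp 2 fun k => inner ℝ (a k) (f : E))
    (fun g => WithLp.toLp 2 fun k => inner ℝ (b k) (g : F))
    (fun f => by
      refine le_of_sq_le_sq ?_ zero_le_one
      rw [EuclideanSpace.real_norm_sq_eq, one_pow]
      exact ha f (hs f f.2))
    (fun g => by
      refine le_of_sq_le_sq ?_ zero_le_one
      rw [EuclideanSpace.real_norm_sq_eq, one_pow]
      exact hb g (ht g g.2))
  have hE : c⁻¹ * Φ (TensorProduct.map (slabMap s) (slabMap t) (∑ k, a k ⊗ₜ[ℝ] b k)) =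
      ∑ f : s, ∑ g : t, A f g * inner ℝ
        (WithLp.toLp 2 fun k => inner ℝ (a k) (f : E) : EuclideanSpace ℝ (Fin d))
        (WithLp.toLp 2 fun k => inner ℝ (b k) (g : F) : EuclideanSpace ℝ (Fin d)) := by
    simp only [map_sum, TensorProduct.map_tmul, Finset.mul_sum, hA, slabMap_apply,
      PiLp.inner_apply, RCLike.inner_apply, conj_trivial]
    rw [Finset.sum_comm]
    refine Finset.sum_congr rfl fun i _ => ?_
    rw [Finset.sum_comm]
    exact Finset.sum_congr rfl fun j _ => Finset.sum_congr rfl fun k _ => by ring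
  rw [← hE] at hG
  have h3 := (le_abs_self _).trans hG
  rw [inv_mul_le_iff₀ hc] at h3
  rw [map_smul, smul_eq_mul, lt_inv_mul_iff₀ hK] at h2
  linarith

variable [FiniteDimensional ℝ E] [FiniteDimensional ℝ F]

/-- Finitely many slabs embed the spaces into ℓ_∞ so that P and Q are nearly sections of cubes. The
inclusion known for cubes descends to the sections by injectivity of β and returns to P and Q by
uniformity. -/
theorem inv_smul_mem_of_isInjective {β : BodyProduct.{u}} (hβ : IsTensorProduct β)
    (hβ' : IsInjective β) (hP : IsSymConvexBody P) (hQ : IsSymConvexBody Q) {u : E ⊗[ℝ] F}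
    (hu : u ∈ weakTwoProd P Q) : grothendieckConstant⁻¹ • u ∈ β E F P Q := by
  refine (hβ.isSymConvexBody E F P Q hP hQ).isCompact.isClosed.mem_of_forall_inv_pow_smul_mem 2
    fun ε hε hε1 => ?_
  have hε0 : (1 + ε)⁻¹ ≠ 0 := by positivity
  -- Indexing ℓ_∞ by the finite set of functionals itself keeps it in the universe on which β is
  -- defined.
  obtain ⟨s, hs, hsP⟩ := exists_finite_slabs hP hε hε1
  obtain ⟨t, ht, htQ⟩ := exists_finite_slabs hQ hε hε1
  obtain ⟨L, hL⟩ := LinearMap.exists_leftInverse_of_injective _ (ker_slabMap hP hε0 hsP)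
  obtain ⟨L', hL'⟩ := LinearMap.exists_leftInverse_of_injective _ (ker_slabMap hQ hε0 htQ)
  set M := LinearMap.range (slabMap s)
  set N := LinearMap.range (slabMap t)
  have hcs := isSymConvexBody_cube s
  have hct := isSymConvexBody_cube t
  have hmem := inv_smul_map_slabMap_mem hβ hs ht hu
  have hrange : grothendieckConstant⁻¹ • TensorProduct.map (slabMap s) (slabMap t) u ∈
      Set.range (TensorProduct.map M.subtype N.subtype) := by
    refine ⟨grothendieckConstant⁻¹ • TensorProduct.map (slabMap s).rangeRestrict
      (slabMap t).rangeRestrict u, ?_⟩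
    rw [map_smul, ← LinearMap.comp_apply, ← TensorProduct.map_comp]
    rfl
  obtain ⟨v, hv, hvu⟩ := (hβ' _ _ _ _ hcs hct M N).ge ⟨hmem, hrange⟩
  have aux : ∀ {G : Type u} [NormedAddCommGroup G] [InnerProductSpace ℝ G] {s : Finset G}
      {R : Set G} {L : EuclideanSpace ℝ s →ₗ[ℝ] G},
      (∀ x : G, (∀ f ∈ s, |inner ℝ x f| ≤ 1) → (1 + ε)⁻¹ • x ∈ R) →
      L ∘ₗ slabMap s = LinearMap.id →
      ((1 + ε)⁻¹ • (L ∘ₗ (LinearMap.range (slabMap s)).subtype)) ''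
        ((LinearMap.range (slabMap s)).subtype ⁻¹' cube s) ⊆ R := by
    rintro G _ _ s R L hR hL _ ⟨⟨_, x, rfl⟩, hx, rfl⟩
    have hLx : L (slabMap s x) = x := LinearMap.congr_fun hL x
    simp only [LinearMap.smul_apply, LinearMap.comp_apply, Submodule.subtype_apply, hLx]
    refine hR x fun f hf => ?_
    rw [← slabMap_apply s x ⟨f, hf⟩]
    exact hx ⟨f, hf⟩
  -- Each left inverse, scaled by (1 + ε)⁻¹, maps the section of the cube into the body; the two
  -- factors give the exponent 2.
  have hfin := hβ.uniform _ _ _ _ _ _ _ _ (hcs.preimage_subtype M) (hct.preimage_subtype N) hP hQ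
    _ _ (aux hsP hL) (aux htQ hL') ⟨v, hv, rfl⟩
  rw [TensorProduct.map_smul_left, TensorProduct.map_smul_right, TensorProduct.map_comp,
    LinearMap.smul_apply, LinearMap.smul_apply, LinearMap.comp_apply, hvu, map_smul,
    ← LinearMap.comp_apply, ← TensorProduct.map_comp, hL, hL', TensorProduct.map_id,
    LinearMap.id_apply, smul_smul, ← sq] at hfin
  exact hfin

end Product

end ConvexTensor

end

theorem mainTheorem4 (E₁ E₂ : Type u)
    [NormedAddCommGroup E₁] [InnerProductSpace ℝ E₁] [FiniteDimensional ℝ E₁]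
    [NormedAddCommGroup E₂] [InnerProductSpace ℝ E₂] [FiniteDimensional ℝ E₂]
    (P₁ : Set E₁) (P₂ : Set E₂)
    (hP₁ : ConvexTensor.IsSymConvexBody P₁) (hP₂ : ConvexTensor.IsSymConvexBody P₂) :
    IsLeast ConvexTensor.grothendieckBounds ConvexTensor.grothendieckConstant ∧
    ConvexTensor.grothendieckConstant⁻¹ • ConvexTensor.hilbertianProd E₁ E₂ P₁ P₂ ⊆
      ConvexTensor.injHull ConvexTensor.projProd E₁ E₂ P₁ P₂ ∧
    ConvexTensor.injHull ConvexTensor.projProd E₁ E₂ P₁ P₂ ⊆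
      ConvexTensor.hilbertianProd E₁ E₂ P₁ P₂ := by
  refine ⟨ConvexTensor.isLeast_grothendieckConstant, ?_, ?_⟩
  · rintro _ ⟨u, hu, rfl⟩
    rw [ConvexTensor.hilbertianProd_eq hP₁ hP₂] at hu
    exact Set.mem_iInter₂.2 fun β hβ =>
      ConvexTensor.inv_smul_mem_of_isInjective hβ.1 hβ.2.1 hP₁ hP₂ hu
  · exact Set.biInter_subset_of_mem (t := fun β : ConvexTensor.BodyProduct => β E₁ E₂ P₁ P₂)
      ⟨ConvexTensor.isTensorProduct_hilbertianProd, ConvexTensor.isInjective_hilbertianProd,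
        ConvexTensor.isTensorProduct_hilbertianProd.proj_subset⟩
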